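/- Let $\rho=\pm1$. In real characteristic coordinates $\xi,\eta$, the equation DS1$^{\rho}$ is the system \[\mathrm i\psi_t+\tfrac12(\psi_{\xi\xi}+\psi_{\eta\eta})+2\phi\psi=0,\qquad \phi_{\xi\eta}+\tfrac{\rho}{2}\big((|\psi|^2)_{\xi\xi}+(|\psi|^2)_{\eta\eta}\big)=0,\] with $\psi$ complex valued and $\phi$ real valued. Let $N\ge1$, $w_a\neq w_b$, $h$, $\theta$ be real, $\kappa_1,\kappa_2\in\mathbb R\setminus\{0\}$, and put $\rho=-\operatorname{sign}(\kappa_1\kappa_2)$, $A=|\kappa_1\kappa_2|^{1/2}|w_a-w_b|^{-1}$, $G_1=\frac{\kappa_1}{w_b-w_a}$, $G_2=\frac{\kappa_2}{w_a-w_b}$, $G_3=-G_1^2-G_2^2+h$, $E=\exp\{-\mathrm i(G_1\xi+G_2\eta-G_3\frac t2)\}$. For $w_{u_k},w_{v_k},d_k\in\mathbb C$ $(1\le k\le 2N)$ and $c\in\{a,b\}$ put $V_{c,k}=\frac1{w_c-w_{v_k}}-\frac1{w_c-w_{u_k}}$, $W_{c,k}=-\frac1{(w_c-w_{v_k})^2}+\frac1{(w_c-w_{u_k})^2}$,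 $r_k=\ln\big\{\frac{w_b-w_{v_k}}{w_b-w_{u_k}}\frac{w_a-w_{u_k}}{w_a-w_{v_k}}\big\}$, $Z_k=\mathrm i\kappa_1V_{a,k}\xi-\mathrm i\kappa_2V_{b,k}\eta+\mathrm i(\kappa_1^2W_{a,k}-\kappa_2^2W_{b,k})\frac t2$, and for $\beta\in\{-1,0,1\}$ let $\mathbb T_\beta$ be the $2N\times2N$ matrix with entries $\delta_{i,k}+\frac{w_{v_i}-w_{u_i}}{w_{v_i}-w_{u_k}}e^{\frac12(z_i+z_k)}$, $z_k=Z_k-d_k+\beta r_k$. Consider \[\psi=Ae^{\mathrm i\theta}\frac{\det\mathbb T_1}{\det\mathbb T_0}E,\quad \psi^*=-\frac{\kappa_1\kappa_2}{Ae^{\mathrm i\theta}(w_a-w_b)^2}\frac{\det\mathbb T_{-1}}{\det\mathbb T_0}E^{-1},\quad \phi=\tfrac12(\ln\det\mathbb T_0)_{\xi\xi}+\tfrac12(\ln\det\mathbb T_0)_{\eta\eta}+\tfrac h4 .\qquad(1)\] **(a) $N$-breathers.** Suppose $w_{v_i}\neq w_{u_k}$ for all $i,k$, and for $k=1,\dots,N$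 \[\overline{d_{2k-1}}\equiv d_{2k}\ (\mathrm{mod}\ 2\pi\mathrm i),\quad \overline{w_{v_{2k}}}=w_{u_{2k-1}},\quad \overline{w_{v_{2k-1}}}=w_{u_{2k}}.\qquad(2)\] Then $\psi^*=\rho\overline\psi$, and $(\psi,\phi)$ in (1) is a smooth solution of DS1$^\rho$ with $\phi$ real, on the open set of real $(\xi,\eta,t)$ with $\det\mathbb T_0\ne0$; this set is dense if moreover the $w_{u_k}$ are pairwise distinct and the $w_{v_k}$ are pairwise distinct. These solutions are the $N$-breathers. **(b) $N$-rational breathers.** Let $w_{u_{2k-1}},w_{v_{2k}},\hat d_{2k-1},\hat d_{2k}\in\mathbb C$, $1\le k\le N$, be such that the $2N$ points $w_{u_{2k-1}},w_{v_{2k}}$ are pairwise distinct, $\overline{\hat d_{2k}}=\hat d_{2k-1}$ and $\overline{w_{u_{2k-1}}}=w_{v_{2k}}$. Put $\hat V_{c,2k-1}=\frac1{(w_c-w_{u_{2k-1}})^2}$, $\hat W_{c,2k-1}=-\frac2{(w_c-w_{u_{2k-1}})^3}$, $\hat r_{2k-1}=-\frac{w_a-w_b}{(w_a-w_{u_{2k-1}})(w_b-w_{u_{2k-1}})}$,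 and $\hat V_{c,2k}=-\overline{\hat V_{c,2k-1}}$, $\hat W_{c,2k}=-\overline{\hat W_{c,2k-1}}$, $\hat r_{2k}=-\overline{\hat r_{2k-1}}$; further $z_k=\mathrm i\kappa_1\hat V_{a,k}\xi-\mathrm i\kappa_2\hat V_{b,k}\eta+\mathrm i(\kappa_1^2\hat W_{a,k}-\kappa_2^2\hat W_{b,k})\frac t2-\hat d_k$. Let $\mathbb K_\beta$ be the $2N\times 2N$ matrix with diagonal entries $-(z_k+\beta\hat r_k)$ and off-diagonal entries $\frac1{w_{v_i}-w_{v_k}}$ ($i,k$ even), $\frac1{w_{v_i}-w_{u_k}}$ ($i$ even, $k$ odd), $-\frac1{w_{u_i}-w_{v_k}}$ ($i$ odd, $k$ even), $-\frac1{w_{u_i}-w_{u_k}}$ ($i,k$ odd). Then $\det\mathbb K_\beta$ is, for every $\beta\in\mathbb C$, a polynomial in $\xi,\eta,t$ of total degree $2N$, the set of real $(\xi,\eta,t)$ with $\det\mathbb K_0\neq0$ is open and dense, and on it \[\psi=Ae^{\mathrm i\theta}\frac{\det\mathbb K_1}{\det\mathbb K_0}E,\qquad \phi=\tfrac12(\ln\det\mathbb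 K_0)_{\xi\xi}+\tfrac12(\ln\det\mathbb K_0)_{\eta\eta}+\tfrac h4\] is a smooth solution of DS1$^\rho$ with $\phi$ real (an $N$-rational breather). It is a limit of (1): let $\alpha_1,\dots,\alpha_{2N}\in\mathbb C\setminus\{0\}$, and for $\epsilon>0$ put $w_{v_{2k-1}}=w_{u_{2k-1}}+\epsilon\alpha_{2k-1}$, $w_{u_{2k}}=w_{v_{2k}}+\epsilon\alpha_{2k}$, $d_k=\epsilon\alpha_k\hat d_k+\mathrm i\pi$ in (1). As $\epsilon\to0^+$, at every point with $\det\mathbb K_0\neq0$ the functions $\psi,\psi^*,\phi$ of (1) converge to $\psi$, $\rho\overline\psi$, $\phi$ of the rational breather. If $\overline{\alpha_{2k-1}}=\alpha_{2k}$ for all $k$, then for all small $\epsilon>0$ these parameters satisfy the conditions of (a), so that the rational breather is a limit of $N$-breathers. -/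

import Mathlib

open Filter Topology

noncomputable section

namespace DaveyStewartson

/-- Points `(ξ, η, t)`: real characteristic coordinates and time. -/
abbrev Pt : Type := ℝ × ℝ × ℝ

/-- The partial derivative `∂f/∂ξ`. -/
def dXi (f : Pt → ℂ) (p : Pt) : ℂ := deriv (fun s : ℝ => f (s, p.2.1, p.2.2)) p.1

/-- The partial derivative `∂f/∂η`. -/
def dEta (f : Pt → ℂ) (p : Pt) : ℂ := deriv (fun s : ℝ => f (p.1, s, p.2.2)) p.2.1

/-- The partial derivative `∂f/∂t`. -/
def dTime (f : Pt → ℂ) (p : Pt) : ℂ := deriv (fun s : ℝ => f (p.1, p.2.1, s)) p.2.2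

/-- The function `|ψ|²`, with values in `ℂ`. -/
def normSqFun (ψ : Pt → ℂ) (p : Pt) : ℂ := ((‖ψ p‖ ^ 2 : ℝ) : ℂ)

/-- `(ψ, φ)` is a smooth solution of the equation DS1 with sign `ρ` on the open set `U` of real
points `(ξ, η, t)`, with `φ` real-valued:
`i ψ_t + (ψ_ξξ + ψ_ηη)/2 + 2 φ ψ = 0` and `φ_ξη + (ρ/2) ((|ψ|²)_ξξ + (|ψ|²)_ηη) = 0`. -/
structure IsDS1SolutionOn (ρ : ℝ) (ψ φ : Pt → ℂ) (U : Set Pt) : Prop where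
  isOpen : IsOpen U
  smooth_psi : ContDiffOn ℝ ((⊤ : ℕ∞) : WithTop ℕ∞) ψ U
  smooth_phi : ContDiffOn ℝ ((⊤ : ℕ∞) : WithTop ℕ∞) φ U
  phi_real : ∀ p ∈ U, (φ p).im = 0
  eq_psi : ∀ p ∈ U,
    Complex.I * dTime ψ p + 1 / 2 * (dXi (dXi ψ) p + dEta (dEta ψ) p) + 2 * φ p * ψ p = 0
  eq_phi : ∀ p ∈ U,
    dXi (dEta φ) p +
      (ρ : ℂ) / 2 * (dXi (dXi (normSqFun ψ)) p + dEta (dEta (normSqFun ψ)) p) = 0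

/-- The sign `ρ = - sign (κ₁ κ₂)`. -/
def rho (κ₁ κ₂ : ℝ) : ℝ := -Real.sign (κ₁ * κ₂)

/-- The amplitude `A e^{iθ}` with `A = |κ₁ κ₂|^{1/2} |w_a - w_b|⁻¹`. -/
def amplitude (wa wb κ₁ κ₂ θ : ℝ) : ℂ :=
  ((Real.sqrt |κ₁ * κ₂| * |wa - wb|⁻¹ : ℝ) : ℂ) * Complex.exp (Complex.I * θ)

/-- The phase `G₁ ξ + G₂ η - G₃ t / 2` of the plane wave, where `G₁ = κ₁ / (w_b - w_a)`,
`G₂ = κ₂ / (w_a - w_b)` and `G₃ = - G₁² - G₂² + h`. -/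
def planePhase (wa wb κ₁ κ₂ h : ℝ) (p : Pt) : ℝ :=
  κ₁ / (wb - wa) * p.1 + κ₂ / (wa - wb) * p.2.1
    - (-(κ₁ / (wb - wa)) ^ 2 - (κ₂ / (wa - wb)) ^ 2 + h) * (p.2.2 / 2)

/-- `½ (ln F)_ξξ + ½ (ln F)_ηη + h/4`, where `(ln F)_ξ` is the logarithmic derivative `F_ξ / F`
(no branch of the logarithm is involved). -/
def phiOf (F : Pt → ℂ) (h : ℝ) (p : Pt) : ℂ :=
  1 / 2 * dXi (fun q => dXi F q / F q) p + 1 / 2 * dEta (fun q => dEta F q / F q) p + (h : ℂ) / 4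

/-- Data of a determinantal solution with index set `ι` (so `g = card ι`). -/
structure DetData (ι : Type) where
  wa : ℝ
  wb : ℝ
  κ₁ : ℝ
  κ₂ : ℝ
  h : ℝ
  u : ι → ℂ
  v : ι → ℂ
  d : ι → ℂ

namespace DetData

variable {ι : Type} (P : DetData ι)

/-- `V_{c,k} = 1/(w_c - w_{v_k}) - 1/(w_c - w_{u_k})`. -/
def V (c : ℝ) (k : ι) : ℂ := 1 / ((c : ℂ) - P.v k) - 1 / ((c : ℂ) - P.u k)

/-- `W_{c,k} = - 1/(w_c - w_{v_k})² + 1/(w_c - w_{u_k})²`. -/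
def W (c : ℝ) (k : ι) : ℂ := -(1 / ((c : ℂ) - P.v k) ^ 2) + 1 / ((c : ℂ) - P.u k) ^ 2

/-- `r_k = ln { (w_b - w_{v_k})/(w_b - w_{u_k}) · (w_a - w_{u_k})/(w_a - w_{v_k}) }`. -/
def r (k : ι) : ℂ :=
  Complex.log (((P.wb : ℂ) - P.v k) / ((P.wb : ℂ) - P.u k) *
    (((P.wa : ℂ) - P.u k) / ((P.wa : ℂ) - P.v k)))

/-- `Z_k = i κ₁ V_{a,k} ξ - i κ₂ V_{b,k} η + i (κ₁² W_{a,k} - κ₂² W_{b,k}) t / 2`. -/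
def Z (p : Pt) (k : ι) : ℂ :=
  Complex.I * P.κ₁ * P.V P.wa k * p.1 - Complex.I * P.κ₂ * P.V P.wb k * p.2.1
    + Complex.I * ((P.κ₁ : ℂ) ^ 2 * P.W P.wa k - (P.κ₂ : ℂ) ^ 2 * P.W P.wb k) * ((p.2.2 : ℂ) / 2)

/-- The argument `z_k = Z_k - d_k + β r_k`. -/
def z (β : ℂ) (p : Pt) (k : ι) : ℂ := P.Z p k - P.d k + β * P.r k

/-- The matrix `𝕋_β`, with entries
`δ_{ik} + (w_{v_i} - w_{u_i})/(w_{v_i} - w_{u_k}) · exp ((z_i + z_k)/2)`. -/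
def T [DecidableEq ι] (β : ℂ) (p : Pt) : Matrix ι ι ℂ := Matrix.of fun i k =>
  (if i = k then 1 else 0) +
    (P.v i - P.u i) / (P.v i - P.u k) * Complex.exp (1 / 2 * (P.z β p i + P.z β p k))

/-- `det 𝕋_β` as a function of `(ξ, η, t)`. -/
def detT [Fintype ι] [DecidableEq ι] (β : ℂ) (p : Pt) : ℂ := (P.T β p).det

/-- `ψ = A (det 𝕋₁ / det 𝕋₀) exp (-i (G₁ ξ + G₂ η - G₃ t/2))`. -/
def psi [Fintype ι] [DecidableEq ι] (A : ℂ) (p : Pt) : ℂ :=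
  A * (P.detT 1 p / P.detT 0 p) *
    Complex.exp (-Complex.I * (planePhase P.wa P.wb P.κ₁ P.κ₂ P.h p : ℂ))

/-- `ψ* = - κ₁ κ₂ / (A (w_a - w_b)²) (det 𝕋₋₁ / det 𝕋₀) exp (i (G₁ ξ + G₂ η - G₃ t/2))`. -/
def psiStar [Fintype ι] [DecidableEq ι] (A : ℂ) (p : Pt) : ℂ :=
  -((P.κ₁ : ℂ) * P.κ₂ / (A * ((P.wa : ℂ) - P.wb) ^ 2)) * (P.detT (-1) p / P.detT 0 p) *
    Complex.exp (Complex.I * (planePhase P.wa P.wb P.κ₁ P.κ₂ P.h p : ℂ))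

/-- `φ = ½ (ln det 𝕋₀)_ξξ + ½ (ln det 𝕋₀)_ηη + h/4`. -/
def phi [Fintype ι] [DecidableEq ι] (p : Pt) : ℂ := phiOf (P.detT 0) P.h p

end DetData

/-- The conditions that single out the `N`-breathers. Here `g = 2N`, and the index `inl k` stands
for the odd index `2k - 1`, the index `inr k` for the even index `2k`. The constants `d_k` enter
the determinants only through `exp (-d_k)`, so the condition on them is one modulo `2πi`. -/
structure DetData.IsBreather {N : ℕ} (P : DetData (Fin N ⊕ Fin N)) : Prop where
  κ₁_ne : P.κ₁ ≠ 0
  κ₂_ne : P.κ₂ ≠ 0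
  wa_ne_wb : P.wa ≠ P.wb
  v_ne_u : ∀ i k, P.v i ≠ P.u k
  conj_d : ∀ k : Fin N, ∃ m : ℤ, (starRingEnd ℂ) (P.d (Sum.inl k)) =
    P.d (Sum.inr k) + 2 * Real.pi * Complex.I * (m : ℂ)
  conj_v_even : ∀ k : Fin N, (starRingEnd ℂ) (P.v (Sum.inr k)) = P.u (Sum.inl k)
  conj_v_odd : ∀ k : Fin N, (starRingEnd ℂ) (P.v (Sum.inl k)) = P.u (Sum.inr k)

/-- Data of a rational solution: `u k` is `w_{u_{2k-1}}`, `v k` is `w_{v_{2k}}`, and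
`d (inl k)`, `d (inr k)` are the constants of index `2k - 1` and `2k`. -/
structure RatData (N : ℕ) where
  wa : ℝ
  wb : ℝ
  κ₁ : ℝ
  κ₂ : ℝ
  h : ℝ
  u : Fin N → ℂ
  v : Fin N → ℂ
  d : Fin N ⊕ Fin N → ℂ

namespace RatData

variable {N : ℕ} (Q : RatData N)

/-- The reality conditions of the rational solutions, and the distinctness of the points
that occur in the denominators. -/
structure IsRationalBreather : Prop where
  κ₁_ne : Q.κ₁ ≠ 0
  κ₂_ne : Q.κ₂ ≠ 0
  wa_ne_wb : Q.wa ≠ Q.wb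
  u_inj : Function.Injective Q.u
  v_inj : Function.Injective Q.v
  u_ne_v : ∀ i k, Q.u i ≠ Q.v k
  conj_d : ∀ k : Fin N, (starRingEnd ℂ) (Q.d (Sum.inr k)) = Q.d (Sum.inl k)
  conj_u : ∀ k : Fin N, (starRingEnd ℂ) (Q.u k) = Q.v k

/-- `V̂_{c,2k-1} = 1/(w_c - w_{u_{2k-1}})²` and `V̂_{c,2k} = - 1/(w_c - w_{v_{2k}})²`. -/
def V (c : ℝ) : Fin N ⊕ Fin N → ℂ
  | Sum.inl k => 1 / ((c : ℂ) - Q.u k) ^ 2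
  | Sum.inr k => -(1 / ((c : ℂ) - Q.v k) ^ 2)

/-- `Ŵ_{c,2k-1} = - 2/(w_c - w_{u_{2k-1}})³` and `Ŵ_{c,2k} = 2/(w_c - w_{v_{2k}})³`. -/
def W (c : ℝ) : Fin N ⊕ Fin N → ℂ
  | Sum.inl k => -(2 / ((c : ℂ) - Q.u k) ^ 3)
  | Sum.inr k => 2 / ((c : ℂ) - Q.v k) ^ 3

/-- `r̂_{2k-1} = - (w_a - w_b)/((w_a - w_{u_{2k-1}}) (w_b - w_{u_{2k-1}}))` and
`r̂_{2k} = (w_a - w_b)/((w_a - w_{v_{2k}}) (w_b - w_{v_{2k}}))`. -/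
def r : Fin N ⊕ Fin N → ℂ
  | Sum.inl k => -(((Q.wa : ℂ) - Q.wb) / (((Q.wa : ℂ) - Q.u k) * ((Q.wb : ℂ) - Q.u k)))
  | Sum.inr k => ((Q.wa : ℂ) - Q.wb) / (((Q.wa : ℂ) - Q.v k) * ((Q.wb : ℂ) - Q.v k))

/-- `z_k = i κ₁ V̂_{a,k} ξ - i κ₂ V̂_{b,k} η + i (κ₁² Ŵ_{a,k} - κ₂² Ŵ_{b,k}) t / 2 - d̂_k`. -/
def z (p : Pt) (k : Fin N ⊕ Fin N) : ℂ :=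
  Complex.I * Q.κ₁ * Q.V Q.wa k * p.1 - Complex.I * Q.κ₂ * Q.V Q.wb k * p.2.1
    + Complex.I * ((Q.κ₁ : ℂ) ^ 2 * Q.W Q.wa k - (Q.κ₂ : ℂ) ^ 2 * Q.W Q.wb k) * ((p.2.2 : ℂ) / 2)
    - Q.d k

/-- The matrix `𝕂_β`; `inl` is an odd index and `inr` an even one. -/
def K (β : ℂ) (p : Pt) : Matrix (Fin N ⊕ Fin N) (Fin N ⊕ Fin N) ℂ := Matrix.of fun
  | Sum.inr i, Sum.inr k =>
      if i = k then -(Q.z p (Sum.inr k) + β * Q.r (Sum.inr k)) else 1 / (Q.v i - Q.v k)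
  | Sum.inr i, Sum.inl k => 1 / (Q.v i - Q.u k)
  | Sum.inl i, Sum.inr k => -(1 / (Q.u i - Q.v k))
  | Sum.inl i, Sum.inl k =>
      if i = k then -(Q.z p (Sum.inl k) + β * Q.r (Sum.inl k)) else -(1 / (Q.u i - Q.u k))

/-- `det 𝕂_β` as a function of `(ξ, η, t)`. -/
def detK (β : ℂ) (p : Pt) : ℂ := (Q.K β p).det

/-- `ψ = A (det 𝕂₁ / det 𝕂₀) exp (-i (G₁ ξ + G₂ η - G₃ t/2))`. -/
def psi (A : ℂ) (p : Pt) : ℂ :=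
  A * (Q.detK 1 p / Q.detK 0 p) *
    Complex.exp (-Complex.I * (planePhase Q.wa Q.wb Q.κ₁ Q.κ₂ Q.h p : ℂ))

/-- `φ = ½ (ln det 𝕂₀)_ξξ + ½ (ln det 𝕂₀)_ηη + h/4`. -/
def phi (p : Pt) : ℂ := phiOf (Q.detK 0) Q.h p

/-- The determinantal data that degenerate to `Q` as `ε → 0`:
`w_{v_{2k-1}} = w_{u_{2k-1}} + ε α_{2k-1}`, `w_{u_{2k}} = w_{v_{2k}} + ε α_{2k}` and
`d_k = ε α_k d̂_k + iπ`. -/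
def deform (α : Fin N ⊕ Fin N → ℂ) (ε : ℝ) : DetData (Fin N ⊕ Fin N) where
  wa := Q.wa
  wb := Q.wb
  κ₁ := Q.κ₁
  κ₂ := Q.κ₂
  h := Q.h
  u := Sum.elim Q.u fun k => Q.v k + ε * α (Sum.inr k)
  v := Sum.elim (fun k => Q.u k + ε * α (Sum.inl k)) Q.v
  d := fun k => ε * α k * Q.d k + Complex.I * Real.pi

end RatData

end DaveyStewartson

end

namespace DaveyStewartson

/-! ### Line derivatives -/

section LineDerivatives

variable {f g : Pt → ℂ} {f' g' : ℂ} {p e : Pt} {U : Set Pt}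

/-! Both families come from one mechanism. Let `H` be a matrix function of `(ξ, η, t)`, and for `c =
a, b` let `P_c = 1/(c - v)` and `Q_c = 1/(c - u)` be vectors, also read as diagonal matrices.
Suppose that `∂_ξ H` is `iκ₁ (P_a Q_aᵀ - P_a H + H Q_a)`, that `∂_η H` is the analogue with pole `b`
and factor `-iκ₂`, and that `∂_t H` is built from the corresponding second-order expressions
(`IsLax`). Write `⟨q, r⟩ = qᵀ H⁻¹ r` (`bracket`). The derivative of a bracket is a quadratic
polynomial in brackets, and the resolvent identity makes products such as `P_a P_b` linear in `P_a`
and `P_b`. Hence all the derivatives that are needed stay polynomial in finitely many brackets.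

With `f = ⟨Q_b, P_a⟩` and `R = 1 + (b - a) f`, the function `ψ = A R E` satisfies the Schrödinger
equation for the potential `½ (ln det H)_ξξ + ½ (ln det H)_ηη + h/4`, by a purely algebraic identity
(`IsLax.schrodinger`). For the second equation, `X = iκ₁ ⟨Q_a, P_a⟩` and `Y = -iκ₂ ⟨Q_b, P_b⟩` are,
up to constants, the logarithmic derivatives of `det H` in `ξ` and `η`. They satisfy `X_η = Y_ξ`,
with common value `κ₁κ₂/(a - b)² (R R' - 1)`, where `R'` is `R` with `a` and `b` exchanged.
Exchanging partial derivatives turns `φ_ξη` into `½ (∂_ξ² + ∂_η²)` of this value, and reality says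
that `R R'` is a constant multiple of `|ψ|²`.

For breathers, `H` is a Cauchy matrix plus a diagonal of exponentials. The Cauchy matrix is
annihilated by the flows, and the diagonal is only rescaled. For rational breathers `u = v`, and the
diagonal grows linearly. Shifting `β` amounts, after scaling rows and columns, to a rank-one
perturbation of `H`, so the quotients of determinants are exactly `R` and `R'`. Conjugation
transposes `H`, swaps paired indices and changes `β` to `-β`, which gives the reality conditions.

Density follows from analyticity once one nonzero value is known. For breathers it is found far out
along a ray, where the rescaled matrix tends to one built from identity rows and an invertible
Cauchy block. For rational breathers it follows from the coefficient of `ξ^(2N)`. The degeneration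
is proved at the level of `H`: the shift `iπ` in `d_k` makes its diagonal entries difference
quotients in `ε`, so `H` converges entrywise and the brackets follow. -/

theorem _root_.HasLineDerivAt.fun_add (hf : HasLineDerivAt ℝ f f' p e) (hg : HasLineDerivAt ℝ g g' p e) :
    HasLineDerivAt ℝ (fun q => f q + g q) (f' + g') p e :=
  HasDerivAt.add hf hg

theorem _root_.HasLineDerivAt.fun_sub (hf : HasLineDerivAt ℝ f f' p e) (hg : HasLineDerivAt ℝ g g' p e) :
    HasLineDerivAt ℝ (fun q => f q - g q) (f' - g') p e :=
  HasDerivAt.sub hf hg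

theorem _root_.HasLineDerivAt.fun_mul (hf : HasLineDerivAt ℝ f f' p e) (hg : HasLineDerivAt ℝ g g' p e) :
    HasLineDerivAt ℝ (fun q => f q * g q) (f' * g p + f p * g') p e := by
  have h := HasDerivAt.mul hf hg
  simp only [zero_smul, add_zero] at h
  exact h

theorem _root_.HasLineDerivAt.fun_const_mul (c : ℂ) (hf : HasLineDerivAt ℝ f f' p e) :
    HasLineDerivAt ℝ (fun q => c * f q) (c * f') p e :=
  HasDerivAt.const_mul c hf

theorem _root_.HasLineDerivAt.fun_const_add (c : ℂ) (hf : HasLineDerivAt ℝ f f' p e) :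
    HasLineDerivAt ℝ (fun q => c + f q) f' p e :=
  HasDerivAt.const_add c hf

theorem _root_.HasLineDerivAt.congr_of_isOpen (hU : IsOpen U) (hp : p ∈ U) (hfg : ∀ q ∈ U, g q = f q)
    (hf : HasLineDerivAt ℝ f f' p e) : HasLineDerivAt ℝ g f' p e :=
  hf.congr_of_eventuallyEq (by filter_upwards [hU.mem_nhds hp] with q hq using hfg q hq)

theorem _root_.HasLineDerivAt.fun_cexp (hf : HasLineDerivAt ℝ f f' p e) :
    HasLineDerivAt ℝ (fun q => Complex.exp (f q)) (Complex.exp (f p) * f') p e := by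
  have h := HasDerivAt.cexp hf
  simp only [zero_smul, add_zero] at h
  exact h

/-- Rewriting the coordinate derivatives as line derivatives lets one set of rules serve all three
variables; the two differ only by a translation of the parameter. -/
theorem dXi_eq_lineDeriv (f : Pt → ℂ) : dXi f = fun p => lineDeriv ℝ f p (1, 0, 0) := by
  funext p
  simp only [dXi, lineDeriv]
  have h := deriv_comp_const_add (fun s : ℝ => f (s, p.2.1, p.2.2)) p.1 0
  rw [add_zero] at h
  rw [← h]
  simp [Prod.add_def]

theorem dEta_eq_lineDeriv (f : Pt → ℂ) : dEta f = fun p => lineDeriv ℝ f p (0, 1, 0) := by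
  funext p
  simp only [dEta, lineDeriv]
  have h := deriv_comp_const_add (fun s : ℝ => f (p.1, s, p.2.2)) p.2.1 0
  rw [add_zero] at h
  rw [← h]
  simp [Prod.add_def]

theorem dTime_eq_lineDeriv (f : Pt → ℂ) : dTime f = fun p => lineDeriv ℝ f p (0, 0, 1) := by
  funext p
  simp only [dTime, lineDeriv]
  have h := deriv_comp_const_add (fun s : ℝ => f (p.1, p.2.1, s)) p.2.2 0
  rw [add_zero] at h
  rw [← h]
  simp [Prod.add_def]

theorem _root_.HasLineDerivAt.dXi_eq (h : HasLineDerivAt ℝ f f' p (1, 0, 0)) : dXi f p = f' := by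
  rw [dXi_eq_lineDeriv]; exact h.lineDeriv

theorem _root_.HasLineDerivAt.dEta_eq (h : HasLineDerivAt ℝ f f' p (0, 1, 0)) : dEta f p = f' := by
  rw [dEta_eq_lineDeriv]; exact h.lineDeriv

theorem _root_.HasLineDerivAt.dTime_eq (h : HasLineDerivAt ℝ f f' p (0, 0, 1)) : dTime f p = f' := by
  rw [dTime_eq_lineDeriv]; exact h.lineDeriv

theorem lineDeriv_congr_of_isOpen (hU : IsOpen U) (hfg : ∀ q ∈ U, f q = g q) (e : Pt) :
    ∀ q ∈ U, lineDeriv ℝ f q e = lineDeriv ℝ g q e := fun q hq =>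
  Filter.EventuallyEq.lineDeriv_eq
    (by filter_upwards [hU.mem_nhds hq] with x hx using hfg x hx)

theorem differentiableAt_of_contDiffOn (hU : IsOpen U)
    (hf : ContDiffOn ℝ ((⊤ : ℕ∞) : WithTop ℕ∞) f U) {q : Pt} (hq : q ∈ U) :
    DifferentiableAt ℝ f q :=
  (hf.contDiffAt (hU.mem_nhds hq)).differentiableAt (by simp)

theorem hasLineDerivAt_of_contDiffOn (hU : IsOpen U)
    (hf : ContDiffOn ℝ ((⊤ : ℕ∞) : WithTop ℕ∞) f U) {q : Pt} (hq : q ∈ U) (e : Pt) :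
    HasLineDerivAt ℝ f (lineDeriv ℝ f q e) q e :=
  (differentiableAt_of_contDiffOn hU hf hq).lineDifferentiableAt.hasLineDerivAt

theorem contDiffOn_lineDeriv (hU : IsOpen U)
    (hf : ContDiffOn ℝ ((⊤ : ℕ∞) : WithTop ℕ∞) f U) (e : Pt) :
    ContDiffOn ℝ ((⊤ : ℕ∞) : WithTop ℕ∞) (fun q => lineDeriv ℝ f q e) U := by
  have h1 : ContDiffOn ℝ ((⊤ : ℕ∞) : WithTop ℕ∞) (fun q => fderiv ℝ f q e) U :=
    (hf.fderiv_of_isOpen hU (by simp)).clm_apply contDiffOn_const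
  exact h1.congr fun q hq => (differentiableAt_of_contDiffOn hU hf hq).lineDeriv_eq_fderiv

theorem lineDeriv_comm (hU : IsOpen U)
    (hf : ContDiffOn ℝ ((⊤ : ℕ∞) : WithTop ℕ∞) f U) (e₁ e₂ : Pt) {q : Pt} (hq : q ∈ U) :
    lineDeriv ℝ (fun x => lineDeriv ℝ f x e₁) q e₂ =
      lineDeriv ℝ (fun x => lineDeriv ℝ f x e₂) q e₁ := by
  have key : ∀ e e' : Pt, lineDeriv ℝ (fun x => lineDeriv ℝ f x e) q e' =
      fderiv ℝ (fderiv ℝ f) q e' e := by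
    intro e e'
    have h1 : lineDeriv ℝ (fun x => lineDeriv ℝ f x e) q e' =
        lineDeriv ℝ (fun x => fderiv ℝ f x e) q e' :=
      lineDeriv_congr_of_isOpen hU
        (fun x hx => (differentiableAt_of_contDiffOn hU hf hx).lineDeriv_eq_fderiv) e' q hq
    have h2 : DifferentiableAt ℝ (fderiv ℝ f) q :=
      ((hf.fderiv_of_isOpen (m := 1) hU (by norm_cast)).contDiffAt (hU.mem_nhds hq)).differentiableAt
        (by simp)
    have h3 := h2.hasFDerivAt.clm_apply (hasFDerivAt_const e q)
    rw [h1, (h3.hasLineDerivAt e').lineDeriv]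
    simp
  rw [key, key]
  exact ((hf.contDiffAt (hU.mem_nhds hq)).isSymmSndFDerivAt (by
    simp only [minSmoothness_of_isRCLikeNormedField]; exact WithTop.coe_le_coe.mpr (le_top : (2 : ℕ∞) ≤ ⊤))).eq _ _

end LineDerivatives

/-! ### Derivatives of determinants and inverses -/

section MatrixCalculus

open scoped Matrix

variable {ι : Type} [Fintype ι] [DecidableEq ι]

/-- Jacobi's formula. The product rule in the Leibniz expansion replaces one column at a time by
that of `M'`, and Cramer's rule identifies the result with a diagonal entry of `adjugate * M'`. -/
theorem hasDerivAt_det {M : ℝ → Matrix ι ι ℂ} {M' : Matrix ι ι ℂ} {s : ℝ}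
    (h : ∀ i j, HasDerivAt (fun x => M x i j) (M' i j) s) :
    HasDerivAt (fun x => (M x).det) (((M s).adjugate * M').trace) s := by
  have h1 : HasDerivAt (fun x => (M x).det)
      (∑ σ : Equiv.Perm ι, ((Equiv.Perm.sign σ : ℤ) : ℂ) *
        ∑ i, (∏ j ∈ Finset.univ.erase i, M s (σ j) j) • M' (σ i) i) s := by
    simp only [Matrix.det_apply']
    refine HasDerivAt.fun_sum fun σ _ => HasDerivAt.const_mul _ ?_
    exact HasDerivAt.fun_finsetProd fun i _ => h (σ i) i
  convert h1 using 1
  have h2 : ∀ i, ((M s).adjugate * M') i i = ((M s).updateCol i (fun k => M' k i)).det := by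
    intro i
    rw [← Matrix.cramer_apply, Matrix.cramer_eq_adjugate_mulVec]
    rfl
  simp only [Matrix.trace, Matrix.diag, h2, Matrix.det_apply', Finset.mul_sum]
  rw [Finset.sum_comm]
  refine Finset.sum_congr rfl fun σ _ => Finset.sum_congr rfl fun i _ => ?_
  rw [← Finset.prod_erase_mul _ _ (Finset.mem_univ i)]
  congr 1
  simp only [Matrix.updateCol_self, smul_eq_mul]
  congr 1
  refine Finset.prod_congr rfl fun j hj => ?_
  rw [Matrix.updateCol_ne (Finset.ne_of_mem_erase hj)]

/-- Writing the inverse as adjugate over determinant gives differentiability; the value then follows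
by differentiating `M⁻¹ M = 1`. -/
theorem hasDerivAt_inv_apply {M : ℝ → Matrix ι ι ℂ} {M' : Matrix ι ι ℂ} {s : ℝ}
    (h : ∀ i j, HasDerivAt (fun x => M x i j) (M' i j) s) (h0 : (M s).det ≠ 0) (i j : ι) :
    HasDerivAt (fun x => (M x)⁻¹ i j) (-((M s)⁻¹ * M' * (M s)⁻¹) i j) s := by
  have hdet := hasDerivAt_det h
  have hdiff : ∀ i j, ∃ c, HasDerivAt (fun x => (M x)⁻¹ i j) c s := by
    intro i j
    have hadj : ∃ c, HasDerivAt (fun x => (M x).adjugate i j) c s := by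
      simp only [Matrix.adjugate_apply]
      -- An entry of the adjugate is the determinant of `M` with row `j` replaced by a constant unit
      -- vector, so that row of the derivative is zero.
      refine ⟨_, hasDerivAt_det
        (M' := Matrix.of fun k l => if k = j then 0 else M' k l) fun k l => ?_⟩
      by_cases hk : k = j
      · subst hk
        simpa using hasDerivAt_const s _
      · simpa [hk, Matrix.updateRow_ne hk] using h k l
    obtain ⟨c, hc⟩ := hadj
    refine ⟨_, ((hdet.inv h0).mul hc).congr_of_eventuallyEq (Eventually.of_forall fun x => ?_)⟩
    simp [Matrix.inv_def]
  choose X₀ hX₀ using hdiff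
  obtain ⟨X, hX⟩ : ∃ X : Matrix ι ι ℂ, ∀ i j, HasDerivAt (fun x => (M x)⁻¹ i j) (X i j) s :=
    ⟨Matrix.of X₀, hX₀⟩
  have hprod : X * M s + (M s)⁻¹ * M' = 0 := by
    ext k l
    have h1 : HasDerivAt (fun x => ∑ m, (M x)⁻¹ k m * M x m l)
        (∑ m, (X k m * M s m l + (M s)⁻¹ k m * M' m l)) s :=
      HasDerivAt.fun_sum fun m _ => (hX k m).mul (h m l)
    have h2 : (fun x => ∑ m, (M x)⁻¹ k m * M x m l) =ᶠ[𝓝 s]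
        fun _ => (1 : Matrix ι ι ℂ) k l := by
      filter_upwards [hdet.continuousAt.eventually_ne h0] with x hx
      rw [← Matrix.mul_apply, Matrix.nonsing_inv_mul _ (isUnit_iff_ne_zero.mpr hx)]
    have h3 := (h1.congr_of_eventuallyEq h2.symm).unique (hasDerivAt_const s _)
    simpa [Matrix.mul_apply, Finset.sum_add_distrib] using h3
  have hXeq : X = -((M s)⁻¹ * M' * (M s)⁻¹) := by
    have h1 : X * M s = -((M s)⁻¹ * M') := eq_neg_of_add_eq_zero_left hprod
    have h2 : X = X * M s * (M s)⁻¹ := by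
      rw [Matrix.mul_assoc, Matrix.mul_nonsing_inv _ (isUnit_iff_ne_zero.mpr h0), Matrix.mul_one]
    rw [h2, h1, Matrix.neg_mul]
  have := hX i j
  rwa [hXeq] at this

theorem contDiff_det {n : WithTop ℕ∞} {H : Pt → Matrix ι ι ℂ}
    (h : ∀ i j, ContDiff ℝ n fun p => H p i j) : ContDiff ℝ n fun p => (H p).det := by
  simp only [Matrix.det_apply']
  exact ContDiff.sum fun σ _ => contDiff_const.mul (contDiff_prod fun i _ => h (σ i) i)

theorem contDiffOn_inv_apply {H : Pt → Matrix ι ι ℂ}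
    (h : ∀ i j, ContDiff ℝ ((⊤ : ℕ∞) : WithTop ℕ∞) fun p => H p i j) (i j : ι) :
    ContDiffOn ℝ ((⊤ : ℕ∞) : WithTop ℕ∞) (fun p => (H p)⁻¹ i j) {p | (H p).det ≠ 0} := by
  have hadj : ContDiff ℝ ((⊤ : ℕ∞) : WithTop ℕ∞) fun p => (H p).adjugate i j := by
    simp only [Matrix.adjugate_apply]
    refine contDiff_det fun k l => ?_
    by_cases hk : k = j
    · subst hk
      simpa using contDiff_const
    · simpa [Matrix.updateRow_ne hk] using h k l
  have h1 : ContDiffOn ℝ ((⊤ : ℕ∞) : WithTop ℕ∞) (fun p => (H p).det⁻¹ * (H p).adjugate i j)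
      {p | (H p).det ≠ 0} :=
    ((contDiff_det h).contDiffOn.inv fun p hp => hp).mul hadj.contDiffOn
  exact h1.congr fun p _ => by simp [Matrix.inv_def]

/-- The matrix determinant lemma; it is what turns a shift of `β` into a bracket. -/
theorem det_add_smul_vecMulVec {A : Matrix ι ι ℂ} (hA : A.det ≠ 0) (c : ℂ) (x y : ι → ℂ) :
    (A + c • Matrix.vecMulVec x y).det = A.det * (1 + c * (y ⬝ᵥ (A⁻¹ *ᵥ x))) := by
  have h := Matrix.det_add_replicateCol_mul_replicateRow (ι := Unit)
    (isUnit_iff_ne_zero.mpr hA) (c • x) y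
  rw [← Matrix.vecMulVec_eq, Matrix.smul_vecMulVec] at h
  rw [h]
  congr 1
  rw [Matrix.det_unique]
  simp [Matrix.mul_assoc, Matrix.mul_apply, dotProduct, Matrix.mulVec, Finset.mul_sum]

end MatrixCalculus

/-! ### Bilinear forms of the inverse matrix and their variation under the flows -/

section Bracket

open scoped Matrix

variable {ι : Type} [Fintype ι] [DecidableEq ι]

/-- The bilinear form of `M⁻¹`. -/
noncomputable def bracket (M : Matrix ι ι ℂ) (x y : ι → ℂ) : ℂ := x ⬝ᵥ (M⁻¹ *ᵥ y)

theorem bracket_eq_sum (M : Matrix ι ι ℂ) (x y : ι → ℂ) :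
    bracket M x y = ∑ i, ∑ j, x i * y j * M⁻¹ i j := by
  simp only [bracket, dotProduct, Matrix.mulVec, Finset.mul_sum]
  exact Finset.sum_congr rfl fun i _ => Finset.sum_congr rfl fun j _ => by ring

theorem bracket_smul_sub_left (M : Matrix ι ι ℂ) (c : ℂ) (x y z : ι → ℂ) :
    bracket M (c • (x - y)) z = c * (bracket M x z - bracket M y z) := by
  simp [bracket, sub_dotProduct]

theorem bracket_smul_sub_right (M : Matrix ι ι ℂ) (c : ℂ) (x y z : ι → ℂ) :
    bracket M z (c • (x - y)) = c * (bracket M z x - bracket M z y) := by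
  simp [bracket, Matrix.mulVec_smul, Matrix.mulVec_sub, dotProduct_sub]

/-- The variation of `M` under the first flow attached to a pair of diagonal matrices. -/
def flowOne (x y : ι → ℂ) (M : Matrix ι ι ℂ) : Matrix ι ι ℂ :=
  Matrix.vecMulVec x y - Matrix.diagonal x * M + M * Matrix.diagonal y

/-- The variation of `M` under the second flow attached to a pair of diagonal matrices. -/
def flowTwo (x y : ι → ℂ) (M : Matrix ι ι ℂ) : Matrix ι ι ℂ :=
  -Matrix.vecMulVec (x ^ 2) y - Matrix.vecMulVec x (y ^ 2) + Matrix.diagonal (x ^ 2) * M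
    - M * Matrix.diagonal (y ^ 2)

theorem flowOne_apply (x y : ι → ℂ) (M : Matrix ι ι ℂ) (i j : ι) :
    flowOne x y M i j = x i * y j + (y j - x i) * M i j := by
  simp [flowOne, Matrix.vecMulVec_apply]; ring

theorem flowTwo_apply (x y : ι → ℂ) (M : Matrix ι ι ℂ) (i j : ι) :
    flowTwo x y M i j = -(x i ^ 2 * y j) - x i * y j ^ 2 + (x i ^ 2 - y j ^ 2) * M i j := by
  simp [flowTwo, Matrix.vecMulVec_apply]; ring

theorem diagonal_mulVec_eq_mul (x y : ι → ℂ) : Matrix.diagonal x *ᵥ y = x * y := by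
  funext i; simp [Matrix.mulVec_diagonal]

theorem vecMul_diagonal_eq_mul (x y : ι → ℂ) : x ᵥ* Matrix.diagonal y = x * y := by
  funext i; simp [Matrix.vecMul_diagonal]

theorem dotProduct_vecMulVec (M : Matrix ι ι ℂ) (q r x y : ι → ℂ) :
    q ⬝ᵥ ((M⁻¹ * Matrix.vecMulVec x y * M⁻¹) *ᵥ r) = bracket M q x * bracket M y r := by
  rw [← Matrix.mulVec_mulVec, ← Matrix.mulVec_mulVec, Matrix.vecMulVec_mulVec]
  simp [bracket, Matrix.mulVec_smul, mul_comm]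

theorem dotProduct_inv_diagonal_mul {M : Matrix ι ι ℂ} (hM : M.det ≠ 0) (q r x : ι → ℂ) :
    q ⬝ᵥ ((M⁻¹ * (Matrix.diagonal x * M) * M⁻¹) *ᵥ r) = bracket M q (x * r) := by
  rw [Matrix.mul_assoc, Matrix.mul_assoc, Matrix.mul_nonsing_inv _ (isUnit_iff_ne_zero.mpr hM),
    Matrix.mul_one, ← Matrix.mulVec_mulVec, diagonal_mulVec_eq_mul, bracket]

theorem dotProduct_inv_mul_diagonal {M : Matrix ι ι ℂ} (hM : M.det ≠ 0) (q r y : ι → ℂ) :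
    q ⬝ᵥ ((M⁻¹ * (M * Matrix.diagonal y) * M⁻¹) *ᵥ r) = bracket M (q * y) r := by
  rw [← Matrix.mul_assoc, Matrix.nonsing_inv_mul _ (isUnit_iff_ne_zero.mpr hM), Matrix.one_mul,
    ← Matrix.mulVec_mulVec, Matrix.dotProduct_mulVec, vecMul_diagonal_eq_mul, bracket]

/-- The rank-one term factors into two brackets, and in the diagonal terms one factor `M` cancels an
inverse. The variation of a bracket is therefore again polynomial in brackets. -/
theorem dotProduct_flowOne {M : Matrix ι ι ℂ} (hM : M.det ≠ 0) (q r x y : ι → ℂ) :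
    q ⬝ᵥ ((M⁻¹ * flowOne x y M * M⁻¹) *ᵥ r) =
      bracket M q x * bracket M y r - bracket M q (x * r) + bracket M (q * y) r := by
  simp only [flowOne, Matrix.mul_add, Matrix.mul_sub, Matrix.add_mul, Matrix.sub_mul,
    Matrix.add_mulVec, Matrix.sub_mulVec, dotProduct_add, dotProduct_sub, dotProduct_vecMulVec,
    dotProduct_inv_diagonal_mul hM, dotProduct_inv_mul_diagonal hM]

theorem dotProduct_flowTwo {M : Matrix ι ι ℂ} (hM : M.det ≠ 0) (q r x y : ι → ℂ) :
    q ⬝ᵥ ((M⁻¹ * flowTwo x y M * M⁻¹) *ᵥ r) =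
      -(bracket M q (x ^ 2) * bracket M y r) - bracket M q x * bracket M (y ^ 2) r
        + bracket M q (x ^ 2 * r) - bracket M (q * y ^ 2) r := by
  simp only [flowTwo, Matrix.mul_add, Matrix.mul_sub, Matrix.add_mul, Matrix.sub_mul,
    Matrix.mul_neg, Matrix.neg_mul, Matrix.neg_mulVec, dotProduct_neg,
    Matrix.add_mulVec, Matrix.sub_mulVec, dotProduct_add, dotProduct_sub, dotProduct_vecMulVec,
    dotProduct_inv_diagonal_mul hM, dotProduct_inv_mul_diagonal hM]

/-- By Jacobi's formula this is the logarithmic derivative of `det M` along the flow: a single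
bracket up to a constant. -/
theorem trace_inv_mul_flowOne {M : Matrix ι ι ℂ} (hM : M.det ≠ 0) (x y : ι → ℂ) :
    (M⁻¹ * flowOne x y M).trace = bracket M y x - ∑ i, x i + ∑ i, y i := by
  have h1 : (M⁻¹ * Matrix.vecMulVec x y).trace = bracket M y x := by
    rw [Matrix.mul_vecMulVec, Matrix.trace_vecMulVec, dotProduct_comm, bracket]
  have h2 : (M⁻¹ * (Matrix.diagonal x * M)).trace = ∑ i, x i := by
    rw [Matrix.trace_mul_comm, Matrix.mul_assoc,
      Matrix.mul_nonsing_inv _ (isUnit_iff_ne_zero.mpr hM), Matrix.mul_one, Matrix.trace_diagonal]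
  have h3 : (M⁻¹ * (M * Matrix.diagonal y)).trace = ∑ i, y i := by
    rw [← Matrix.mul_assoc, Matrix.nonsing_inv_mul _ (isUnit_iff_ne_zero.mpr hM), Matrix.one_mul,
      Matrix.trace_diagonal]
  rw [flowOne, Matrix.mul_add, Matrix.mul_sub, Matrix.trace_add, Matrix.trace_sub, h1, h2, h3]

theorem hasLineDerivAt_bracket {H : Pt → Matrix ι ι ℂ} {M' : Matrix ι ι ℂ} {p e : Pt}
    (h : ∀ i j, HasLineDerivAt ℝ (fun x => H x i j) (M' i j) p e) (h0 : (H p).det ≠ 0)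
    (q r : ι → ℂ) :
    HasLineDerivAt ℝ (fun x => bracket (H x) q r)
      (-(q ⬝ᵥ (((H p)⁻¹ * M' * (H p)⁻¹) *ᵥ r))) p e := by
  have h1 : ∀ i j, HasLineDerivAt ℝ (fun x => (H x)⁻¹ i j)
      (-((H p)⁻¹ * M' * (H p)⁻¹) i j) p e := by
    intro i j
    have := hasDerivAt_inv_apply (M := fun t : ℝ => H (p + t • e)) (M' := M') (s := 0) h
      (by simpa using h0) i j
    simp only [zero_smul, add_zero] at this
    exact this
  simp only [bracket_eq_sum]
  have h2 : HasLineDerivAt ℝ (fun x => ∑ i, ∑ j, q i * r j * (H x)⁻¹ i j)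
      (∑ i, ∑ j, q i * r j * (-((H p)⁻¹ * M' * (H p)⁻¹) i j)) p e :=
    HasDerivAt.fun_sum fun i _ => HasDerivAt.fun_sum fun j _ =>
      HasLineDerivAt.fun_const_mul _ (h1 i j)
  convert h2 using 1
  simp only [dotProduct, Matrix.mulVec, Finset.mul_sum, ← Finset.sum_neg_distrib]
  exact Finset.sum_congr rfl fun i _ => Finset.sum_congr rfl fun j _ => by ring

theorem hasLineDerivAt_det {H : Pt → Matrix ι ι ℂ} {M' : Matrix ι ι ℂ} {p e : Pt}
    (h : ∀ i j, HasLineDerivAt ℝ (fun x => H x i j) (M' i j) p e) (h0 : (H p).det ≠ 0) :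
    HasLineDerivAt ℝ (fun x => (H x).det) ((H p).det * ((H p)⁻¹ * M').trace) p e := by
  have h1 := hasDerivAt_det (M := fun t : ℝ => H (p + t • e)) (M' := M') (s := 0) h
  simp only [zero_smul, add_zero] at h1
  have h2 : (H p).det * ((H p)⁻¹ * M').trace = ((H p).adjugate * M').trace := by
    rw [Matrix.inv_def, Ring.inverse_eq_inv', Matrix.smul_mul, Matrix.trace_smul, smul_eq_mul,
      mul_inv_cancel_left₀ h0]
  rw [h2]
  exact h1

theorem contDiffOn_bracket {H : Pt → Matrix ι ι ℂ}
    (h : ∀ i j, ContDiff ℝ ((⊤ : ℕ∞) : WithTop ℕ∞) fun p => H p i j) (q r : ι → ℂ) :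
    ContDiffOn ℝ ((⊤ : ℕ∞) : WithTop ℕ∞) (fun p => bracket (H p) q r)
      {p | (H p).det ≠ 0} := by
  simp only [bracket_eq_sum]
  exact ContDiffOn.sum fun i _ => ContDiffOn.sum fun j _ =>
    contDiffOn_const.mul (contDiffOn_inv_apply h i j)

end Bracket

/-- The diagonal of `(c - diag w)⁻¹`. -/
noncomputable def resolvent {ι : Type} (c : ℝ) (w : ι → ℂ) : ι → ℂ := fun i => 1 / ((c : ℂ) - w i)

/-- Partial fractions. This identity closes the system of brackets, since products with different
poles become linear. -/
theorem resolvent_mul_resolvent {ι : Type} {b c : ℝ} {w : ι → ℂ} (hbc : b ≠ c)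
    (hb : ∀ i, (b : ℂ) ≠ w i) (hc : ∀ i, (c : ℂ) ≠ w i) :
    resolvent b w * resolvent c w = (1 / ((c : ℂ) - b)) • (resolvent b w - resolvent c w) := by
  funext i
  have h1 := sub_ne_zero.mpr (hb i)
  have h2 := sub_ne_zero.mpr (hc i)
  have h3 : (c : ℂ) - b ≠ 0 := sub_ne_zero.mpr (by exact_mod_cast hbc.symm)
  simp only [resolvent, Pi.mul_apply, Pi.smul_apply, Pi.sub_apply, smul_eq_mul]
  field_simp
  ring

/-! ### Evolution of brackets and determinants under the flows -/

section Lax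

variable {ι : Type} [Fintype ι] [DecidableEq ι]

/-- The matrix function `H` evolves by the commuting flows with poles `a` and `b` that underlie the
DS1 equation. -/
structure IsLax (a b κ₁ κ₂ : ℝ) (u v : ι → ℂ) (H : Pt → Matrix ι ι ℂ) : Prop where
  ne : a ≠ b
  a_ne_u : ∀ i, (a : ℂ) ≠ u i
  a_ne_v : ∀ i, (a : ℂ) ≠ v i
  b_ne_u : ∀ i, (b : ℂ) ≠ u i
  b_ne_v : ∀ i, (b : ℂ) ≠ v i
  smooth : ∀ i j, ContDiff ℝ ((⊤ : ℕ∞) : WithTop ℕ∞) fun p => H p i j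
  deriv_xi : ∀ p i j, HasLineDerivAt ℝ (fun x => H x i j)
    (((Complex.I * κ₁) • flowOne (resolvent a v) (resolvent a u) (H p)) i j) p (1, 0, 0)
  deriv_eta : ∀ p i j, HasLineDerivAt ℝ (fun x => H x i j)
    (((-(Complex.I * κ₂)) • flowOne (resolvent b v) (resolvent b u) (H p)) i j) p (0, 1, 0)
  deriv_time : ∀ p i j, HasLineDerivAt ℝ (fun x => H x i j)
    (((Complex.I * κ₁ ^ 2 / 2) • flowTwo (resolvent a v) (resolvent a u) (H p)
      - (Complex.I * κ₂ ^ 2 / 2) • flowTwo (resolvent b v) (resolvent b u) (H p)) i j)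
      p (0, 0, 1)

/-- `½ (ln det H)_ξξ + ½ (ln det H)_ηη + h/4` in terms of `H⁻¹`. -/
noncomputable def phiBracket (a b κ₁ κ₂ h : ℝ) (u v : ι → ℂ) (M : Matrix ι ι ℂ) : ℂ :=
  1 / 2 * ((Complex.I * κ₁) * ((Complex.I * κ₁) *
      (bracket M (resolvent a u) (resolvent a v ^ 2) - bracket M (resolvent a u ^ 2) (resolvent a v)
        - bracket M (resolvent a u) (resolvent a v) ^ 2))) +
    1 / 2 * ((-(Complex.I * κ₂)) * ((-(Complex.I * κ₂)) *
      (bracket M (resolvent b u) (resolvent b v ^ 2) - bracket M (resolvent b u ^ 2) (resolvent b v)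
        - bracket M (resolvent b u) (resolvent b v) ^ 2))) + (h : ℂ) / 4

variable {a b κ₁ κ₂ : ℝ} {u v : ι → ℂ} {H : Pt → Matrix ι ι ℂ}

namespace IsLax

variable (hL : IsLax a b κ₁ κ₂ u v H)

include hL

theorem isOpen : IsOpen {p | (H p).det ≠ 0} :=
  isOpen_ne_fun (contDiff_det hL.smooth).continuous continuous_const

theorem bracket_xi {p : Pt} (hp : (H p).det ≠ 0) (q r : ι → ℂ) :
    HasLineDerivAt ℝ (fun x => bracket (H x) q r)
      (Complex.I * κ₁ * (bracket (H p) q (resolvent a v * r) - bracket (H p) (q * resolvent a u) r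
        - bracket (H p) q (resolvent a v) * bracket (H p) (resolvent a u) r)) p (1, 0, 0) := by
  convert hasLineDerivAt_bracket (hL.deriv_xi p) hp q r using 1
  rw [Matrix.mul_smul, Matrix.smul_mul, Matrix.smul_mulVec, dotProduct_smul,
    dotProduct_flowOne hp, smul_eq_mul]
  ring

theorem bracket_eta {p : Pt} (hp : (H p).det ≠ 0) (q r : ι → ℂ) :
    HasLineDerivAt ℝ (fun x => bracket (H x) q r)
      (-(Complex.I * κ₂) * (bracket (H p) q (resolvent b v * r)
        - bracket (H p) (q * resolvent b u) r
        - bracket (H p) q (resolvent b v) * bracket (H p) (resolvent b u) r)) p (0, 1, 0) := by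
  convert hasLineDerivAt_bracket (hL.deriv_eta p) hp q r using 1
  rw [Matrix.mul_smul, Matrix.smul_mul, Matrix.smul_mulVec, dotProduct_smul,
    dotProduct_flowOne hp, smul_eq_mul]
  ring

theorem bracket_time {p : Pt} (hp : (H p).det ≠ 0) (q r : ι → ℂ) :
    HasLineDerivAt ℝ (fun x => bracket (H x) q r)
      (-(Complex.I * κ₁ ^ 2 / 2) * (bracket (H p) q (resolvent a v ^ 2 * r)
        - bracket (H p) (q * resolvent a u ^ 2) r
        - bracket (H p) q (resolvent a v ^ 2) * bracket (H p) (resolvent a u) r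
        - bracket (H p) q (resolvent a v) * bracket (H p) (resolvent a u ^ 2) r)
      + Complex.I * κ₂ ^ 2 / 2 * (bracket (H p) q (resolvent b v ^ 2 * r)
        - bracket (H p) (q * resolvent b u ^ 2) r
        - bracket (H p) q (resolvent b v ^ 2) * bracket (H p) (resolvent b u) r
        - bracket (H p) q (resolvent b v) * bracket (H p) (resolvent b u ^ 2) r))
      p (0, 0, 1) := by
  convert hasLineDerivAt_bracket (hL.deriv_time p) hp q r using 1
  rw [Matrix.mul_sub, Matrix.sub_mul, Matrix.sub_mulVec, dotProduct_sub]
  rw [Matrix.mul_smul, Matrix.smul_mul, Matrix.smul_mulVec, dotProduct_smul,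
    Matrix.mul_smul, Matrix.smul_mul, Matrix.smul_mulVec, dotProduct_smul,
    dotProduct_flowTwo hp, dotProduct_flowTwo hp, smul_eq_mul, smul_eq_mul]
  ring

theorem det_xi {p : Pt} (hp : (H p).det ≠ 0) :
    HasLineDerivAt ℝ (fun x => (H x).det) ((H p).det * (Complex.I * κ₁ *
      (bracket (H p) (resolvent a u) (resolvent a v)
        - ∑ i, resolvent a v i + ∑ i, resolvent a u i))) p (1, 0, 0) := by
  convert hasLineDerivAt_det (hL.deriv_xi p) hp using 1
  rw [Matrix.mul_smul, Matrix.trace_smul, trace_inv_mul_flowOne hp, smul_eq_mul]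

theorem det_eta {p : Pt} (hp : (H p).det ≠ 0) :
    HasLineDerivAt ℝ (fun x => (H x).det) ((H p).det * (-(Complex.I * κ₂) *
      (bracket (H p) (resolvent b u) (resolvent b v)
        - ∑ i, resolvent b v i + ∑ i, resolvent b u i))) p (0, 1, 0) := by
  convert hasLineDerivAt_det (hL.deriv_eta p) hp using 1
  rw [Matrix.mul_smul, Matrix.trace_smul, trace_inv_mul_flowOne hp, smul_eq_mul]

/-- `½ (ln F)_ξξ + ½ (ln F)_ηη + h/4` when `F` is `det H` up to the exponential of a linear
function. -/
theorem phiOf_eq {F γ : Pt → ℂ} {c₁ c₂ : ℂ} (hF : ∀ p, F p = γ p * (H p).det)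
    (hγ : ∀ p, γ p ≠ 0) (h₁ : ∀ p, HasLineDerivAt ℝ γ (c₁ * γ p) p (1, 0, 0))
    (h₂ : ∀ p, HasLineDerivAt ℝ γ (c₂ * γ p) p (0, 1, 0)) (h : ℝ) {p : Pt}
    (hp : (H p).det ≠ 0) : phiOf F h p = phiBracket a b κ₁ κ₂ h u v (H p) := by
  have hFe : F = fun p => γ p * (H p).det := funext hF
  -- The factor `γ` and the traces of the resolvents contribute only constants to the logarithmic
  -- derivative, so they disappear at the second differentiation.
  have e1 : ∀ q ∈ {p | (H p).det ≠ 0}, dXi F q / F q =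
      (c₁ + Complex.I * κ₁ * (- ∑ i, resolvent a v i + ∑ i, resolvent a u i)) +
      Complex.I * κ₁ * bracket (H q) (resolvent a u) (resolvent a v) := by
    intro q hq
    have hq' : (H q).det ≠ 0 := hq
    have hγq := hγ q
    rw [hFe, ((h₁ q).fun_mul (hL.det_xi hq)).dXi_eq]
    field_simp
    ring
  have e2 : ∀ q ∈ {p | (H p).det ≠ 0}, dEta F q / F q =
      (c₂ + -(Complex.I * κ₂) * (- ∑ i, resolvent b v i + ∑ i, resolvent b u i)) +
      -(Complex.I * κ₂) * bracket (H q) (resolvent b u) (resolvent b v) := by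
    intro q hq
    have hq' : (H q).det ≠ 0 := hq
    have hγq := hγ q
    rw [hFe, ((h₂ q).fun_mul (hL.det_eta hq)).dEta_eq]
    field_simp
    ring
  rw [phiOf, (((hL.bracket_xi hp (resolvent a u) (resolvent a v)).fun_const_mul _).fun_const_add
    _ |>.congr_of_isOpen hL.isOpen hp e1).dXi_eq,
    (((hL.bracket_eta hp (resolvent b u) (resolvent b v)).fun_const_mul _).fun_const_add
    _ |>.congr_of_isOpen hL.isOpen hp e2).dEta_eq, phiBracket]
  simp only [← pow_two]

theorem a_ne_b_cast : (b : ℂ) - a ≠ 0 := sub_ne_zero.mpr (by exact_mod_cast hL.ne.symm)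

/-- With this and `bracket_eta_mixed`, the `ξ`-derivative of the bracket at `b` and the
`η`-derivative of the bracket at `a` contain the same expression. This is the compatibility `X_η =
Y_ξ`. -/
theorem bracket_xi_mixed {p : Pt} (hp : (H p).det ≠ 0) :
    HasLineDerivAt ℝ (fun x => bracket (H x) (resolvent b u) (resolvent b v))
      (Complex.I * κ₁ * (1 / ((b : ℂ) - a) * (bracket (H p) (resolvent b u) (resolvent a v)
        - bracket (H p) (resolvent a u) (resolvent b v))
        - bracket (H p) (resolvent b u) (resolvent a v)
          * bracket (H p) (resolvent a u) (resolvent b v))) p (1, 0, 0) := by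
  convert hL.bracket_xi hp (resolvent b u) (resolvent b v) using 2
  rw [mul_comm (resolvent b u), resolvent_mul_resolvent hL.ne hL.a_ne_u hL.b_ne_u,
    resolvent_mul_resolvent hL.ne hL.a_ne_v hL.b_ne_v, bracket_smul_sub_left,
    bracket_smul_sub_right]
  ring

theorem bracket_eta_mixed {p : Pt} (hp : (H p).det ≠ 0) :
    HasLineDerivAt ℝ (fun x => bracket (H x) (resolvent a u) (resolvent a v))
      (-(Complex.I * κ₂) * (1 / ((b : ℂ) - a) * (bracket (H p) (resolvent b u) (resolvent a v)
        - bracket (H p) (resolvent a u) (resolvent b v))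
        - bracket (H p) (resolvent b u) (resolvent a v)
          * bracket (H p) (resolvent a u) (resolvent b v))) p (0, 1, 0) := by
  convert hL.bracket_eta hp (resolvent a u) (resolvent a v) using 2
  rw [mul_comm (resolvent b v), resolvent_mul_resolvent hL.ne hL.a_ne_u hL.b_ne_u,
    resolvent_mul_resolvent hL.ne hL.a_ne_v hL.b_ne_v, bracket_smul_sub_left,
    bracket_smul_sub_right]
  ring

theorem contDiffOn_phiBracket (h : ℝ) : ContDiffOn ℝ ((⊤ : ℕ∞) : WithTop ℕ∞)
    (fun p => phiBracket a b κ₁ κ₂ h u v (H p)) {p | (H p).det ≠ 0} := by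
  have hs := fun q r => contDiffOn_bracket hL.smooth q r
  unfold phiBracket
  refine ContDiffOn.add (ContDiffOn.add ?_ ?_) contDiffOn_const <;>
  exact contDiffOn_const.mul (contDiffOn_const.mul (contDiffOn_const.mul
    (((hs _ _).sub (hs _ _)).sub ((hs _ _).pow 2))))

end IsLax

end Lax

/-! ### The Schrödinger equation -/

section Lax

variable {ι : Type} [Fintype ι] [DecidableEq ι]

/-- The function `1 + (b - a) ⟨(b - u)⁻¹, M⁻¹ (a - v)⁻¹⟩`, a quotient of determinants. -/
noncomputable def detRatio (a b : ℝ) (u v : ι → ℂ) (M : Matrix ι ι ℂ) : ℂ :=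
  1 + ((b : ℂ) - a) * bracket M (resolvent b u) (resolvent a v)

variable {a b κ₁ κ₂ : ℝ} {u v : ι → ℂ} {H : Pt → Matrix ι ι ℂ}

namespace IsLax

theorem hasLineDerivAt_planeWave (a b κ₁ κ₂ h : ℝ) (p : Pt) :
    HasLineDerivAt ℝ (fun q => Complex.exp (-Complex.I * (planePhase a b κ₁ κ₂ h q : ℂ)))
      (-(Complex.I * (κ₁ / (b - a))) *
        Complex.exp (-Complex.I * (planePhase a b κ₁ κ₂ h p : ℂ))) p (1, 0, 0) ∧
    HasLineDerivAt ℝ (fun q => Complex.exp (-Complex.I * (planePhase a b κ₁ κ₂ h q : ℂ)))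
      (-(Complex.I * (κ₂ / (a - b))) *
        Complex.exp (-Complex.I * (planePhase a b κ₁ κ₂ h p : ℂ))) p (0, 1, 0) ∧
    HasLineDerivAt ℝ (fun q => Complex.exp (-Complex.I * (planePhase a b κ₁ κ₂ h q : ℂ)))
      (Complex.I * ((-(κ₁ / (b - a)) ^ 2 - (κ₂ / (a - b)) ^ 2 + h) / 2) *
        Complex.exp (-Complex.I * (planePhase a b κ₁ κ₂ h p : ℂ))) p (0, 0, 1) := by
  have key : ∀ (e : Pt) (c : ℝ), (∀ q t, planePhase a b κ₁ κ₂ h (q + t • e) =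
      planePhase a b κ₁ κ₂ h q + t * c) →
      HasLineDerivAt ℝ (fun q => Complex.exp (-Complex.I * (planePhase a b κ₁ κ₂ h q : ℂ)))
      (-(Complex.I * c) * Complex.exp (-Complex.I * (planePhase a b κ₁ κ₂ h p : ℂ))) p e := by
    intro e c hc
    have h1 : HasLineDerivAt ℝ (fun q => ((planePhase a b κ₁ κ₂ h q : ℝ) : ℂ)) (c : ℂ) p e := by
      apply HasDerivAt.ofReal_comp
      simp only [hc]
      simpa using ((hasDerivAt_id (0 : ℝ)).mul_const c).const_add (planePhase a b κ₁ κ₂ h p)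
    convert (h1.fun_const_mul (-Complex.I)).fun_cexp using 1
    ring
  refine ⟨?_, ?_, ?_⟩
  · convert key (1, 0, 0) (κ₁ / (b - a)) fun q t => ?_ using 2
    · push_cast; ring
    · simp [planePhase]; ring
  · convert key (0, 1, 0) (κ₂ / (a - b)) fun q t => ?_ using 2
    · push_cast; ring
    · simp [planePhase]; ring
  · convert key (0, 0, 1) (-((-(κ₁ / (b - a)) ^ 2 - (κ₂ / (a - b)) ^ 2 + h) / 2))
      fun q t => ?_ using 2
    · push_cast; ring
    · simp [planePhase]; ring

theorem contDiff_planeWave (a b κ₁ κ₂ h : ℝ) : ContDiff ℝ ((⊤ : ℕ∞) : WithTop ℕ∞)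
    fun q => Complex.exp (-Complex.I * (planePhase a b κ₁ κ₂ h q : ℂ)) := by
  have h1 : ContDiff ℝ ((⊤ : ℕ∞) : WithTop ℕ∞) fun q => planePhase a b κ₁ κ₂ h q := by
    unfold planePhase
    fun_prop
  exact (contDiff_const.mul (Complex.ofRealCLM.contDiff.comp h1)).cexp

variable (hL : IsLax a b κ₁ κ₂ u v H)

include hL

/-- The Schrödinger equation of the DS1 system. -/
theorem schrodinger {A : ℂ} {ψ φ : Pt → ℂ} {h : ℝ}
    (hψ : ∀ p ∈ {p | (H p).det ≠ 0}, ψ p = A * (detRatio a b u v (H p) *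
      Complex.exp (-Complex.I * (planePhase a b κ₁ κ₂ h p : ℂ))))
    (hφ : ∀ p ∈ {p | (H p).det ≠ 0}, φ p = phiBracket a b κ₁ κ₂ h u v (H p)) {p : Pt}
    (hp : (H p).det ≠ 0) :
    Complex.I * dTime ψ p + 1 / 2 * (dXi (dXi ψ) p + dEta (dEta ψ) p) + 2 * φ p * ψ p = 0 := by
  have hD := hL.a_ne_b_cast
  -- Naming `b - a` and its inverse, linked only by `D * δ = 1`, keeps the final identity free of
  -- divisions.
  obtain ⟨δ, hδ⟩ : ∃ δ : ℂ, δ = 1 / ((b : ℂ) - a) := ⟨_, rfl⟩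
  obtain ⟨D, hDdef⟩ : ∃ D : ℂ, D = (b : ℂ) - a := ⟨_, rfl⟩
  have hDδ : D * δ = 1 := by rw [hδ, hDdef]; field_simp
  set Qa := resolvent a u with hQa
  set Qb := resolvent b u with hQb
  set Pa := resolvent a v with hPa
  set Pb := resolvent b v with hPb
  have mulQ : Qa * Qb = δ • (Qa - Qb) := by
    rw [hδ]; exact resolvent_mul_resolvent hL.ne hL.a_ne_u hL.b_ne_u
  have mulP : Pa * Pb = δ • (Pa - Pb) := by
    rw [hδ]; exact resolvent_mul_resolvent hL.ne hL.a_ne_v hL.b_ne_v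
  have mQ : Qb * Qa = δ • (Qa - Qb) := by rw [mul_comm, mulQ]
  have mP : Pb * Pa = δ • (Pa - Pb) := by rw [mul_comm, mulP]
  -- The time flow brings in squared resolvents; applying the resolvent identity twice makes these
  -- mixed products linear in pure powers.
  have mQ2 : Qb * Qa ^ 2 = δ • (Qa ^ 2 - δ • (Qa - Qb)) := by
    rw [pow_two, ← mul_assoc, mQ, smul_mul_assoc, sub_mul, mQ]
  have mP2 : Pb ^ 2 * Pa = (-δ) • (Pb ^ 2 - δ • (Pa - Pb)) := by
    rw [pow_two, mul_assoc, mP, mul_smul_comm, mul_sub, mP, neg_smul, ← smul_neg, neg_sub]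
  have mPa : Pa * Pa = Pa ^ 2 := (pow_two _).symm
  have mPa2 : Pa * Pa ^ 2 = Pa ^ 3 := by ring
  have mPa2' : Pa ^ 2 * Pa = Pa ^ 3 := by ring
  have mQb : Qb * Qb = Qb ^ 2 := (pow_two _).symm
  have mQb2 : Qb ^ 2 * Qb = Qb ^ 3 := by ring
  have mQb2' : Qb * Qb ^ 2 = Qb ^ 3 := by ring
  let br : (ι → ℂ) → (ι → ℂ) → Pt → ℂ := fun q r x => bracket (H x) q r
  let E : Pt → ℂ := fun x => Complex.exp (-Complex.I * (planePhase a b κ₁ κ₂ h x : ℂ))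
  have hopen := hL.isOpen
  have wave := hasLineDerivAt_planeWave a b κ₁ κ₂ h
  have dδ : ((κ₁ : ℂ) / ((b : ℂ) - a)) = κ₁ * δ := by rw [hδ]; ring
  have dδ' : ((κ₂ : ℂ) / ((a : ℂ) - b)) = -(κ₂ * δ) := by
    rw [hδ, ← neg_sub (b : ℂ) a, div_neg]; ring
  simp only [dδ, dδ'] at wave
  -- first derivatives along `ξ`
  have x_f : ∀ x ∈ {p | (H p).det ≠ 0}, HasLineDerivAt ℝ (br Qb Pa)
      (Complex.I * κ₁ * (br Qb (Pa ^ 2) x - δ * (br Qa Pa x - br Qb Pa x)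
        - br Qb Pa x * br Qa Pa x)) x (1, 0, 0) := by
    intro x hx
    convert hL.bracket_xi hx Qb Pa using 2
    rw [mQ, mPa, bracket_smul_sub_left]
  have x_A := hL.bracket_xi hp Qa Pa
  have x_g := hL.bracket_xi hp Qb (Pa ^ 2)
  rw [mPa, ← pow_two] at x_A
  rw [mQ, mPa2, bracket_smul_sub_left] at x_g
  -- first derivatives along `η`
  have y_f : ∀ x ∈ {p | (H p).det ≠ 0}, HasLineDerivAt ℝ (br Qb Pa)
      (-(Complex.I * κ₂) * (δ * (br Qb Pa x - br Qb Pb x) - br (Qb ^ 2) Pa x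
        - br Qb Pb x * br Qb Pa x)) x (0, 1, 0) := by
    intro x hx
    convert hL.bracket_eta hx Qb Pa using 2
    rw [mQb, mP, bracket_smul_sub_right]
  have y_A := hL.bracket_eta hp Qb Pb
  have y_m := hL.bracket_eta hp (Qb ^ 2) Pa
  rw [mQb, ← pow_two] at y_A
  rw [mP, mQb2, bracket_smul_sub_right] at y_m
  have t_f := hL.bracket_time hp Qb Pa
  rw [mQ2, mP2, mPa2', mQb2', bracket_smul_sub_left, bracket_smul_sub_left,
    bracket_smul_sub_right, bracket_smul_sub_right] at t_f
  -- the function `ψ` and its derivatives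
  have hψ' : ∀ x ∈ {p | (H p).det ≠ 0}, ψ x = A * ((1 + D * br Qb Pa x) * E x) := by
    intro x hx
    rw [hψ x hx, hDdef]
    rfl
  have dt := ((((t_f.fun_const_mul D).fun_const_add 1).fun_mul (wave p).2.2).fun_const_mul
    A).congr_of_isOpen hopen hp hψ'
  have dx : ∀ x ∈ {p | (H p).det ≠ 0}, dXi ψ x = A * (D * (Complex.I * κ₁ *
      (br Qb (Pa ^ 2) x - δ * (br Qa Pa x - br Qb Pa x) - br Qb Pa x * br Qa Pa x)) * E x
        + (1 + D * br Qb Pa x) * (-(Complex.I * (κ₁ * δ)) * E x)) := fun x hx =>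
    (((((x_f x hx).fun_const_mul D).fun_const_add 1).fun_mul (wave x).1).fun_const_mul
    A).congr_of_isOpen hopen hx hψ' |>.dXi_eq
  have dy : ∀ x ∈ {p | (H p).det ≠ 0}, dEta ψ x = A * (D * (-(Complex.I * κ₂) *
      (δ * (br Qb Pa x - br Qb Pb x) - br (Qb ^ 2) Pa x
        - br Qb Pb x * br Qb Pa x)) * E x
        + (1 + D * br Qb Pa x) * (-(Complex.I * -(κ₂ * δ)) * E x)) := fun x hx =>
    (((((y_f x hx).fun_const_mul D).fun_const_add 1).fun_mul (wave x).2.1).fun_const_mul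
    A).congr_of_isOpen hopen hx hψ' |>.dEta_eq
  have dxx := (((((((x_g.fun_sub ((x_A.fun_sub (x_f p hp)).fun_const_mul δ)).fun_sub
    ((x_f p hp).fun_mul x_A)).fun_const_mul (Complex.I * κ₁)).fun_const_mul D).fun_mul
    (wave p).1).fun_add ((((x_f p hp).fun_const_mul D).fun_const_add 1).fun_mul
    ((wave p).1.fun_const_mul (-(Complex.I * (κ₁ * δ)))))).fun_const_mul A).congr_of_isOpen
    hopen hp dx
  have dyy := ((((((((y_f p hp).fun_sub y_A).fun_const_mul δ).fun_sub y_m).fun_sub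
    (y_A.fun_mul (y_f p hp))).fun_const_mul (-(Complex.I * κ₂))).fun_const_mul D).fun_mul
    (wave p).2.1).fun_add ((((y_f p hp).fun_const_mul D).fun_const_add 1).fun_mul
    ((wave p).2.1.fun_const_mul (-(Complex.I * -(κ₂ * δ))))) |>.fun_const_mul A
    |>.congr_of_isOpen hopen hp dy
  rw [dt.dTime_eq, dxx.dXi_eq, dyy.dEta_eq, hφ p hp, hψ' p hp, phiBracket]
  rw [← hQa, ← hQb, ← hPa, ← hPb]
  simp only [br, E]
  have hI : Complex.I ^ 2 = -1 := Complex.I_sq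
  generalize Complex.exp _ = e
  generalize bracket (H p) Qb Pa = f
  generalize bracket (H p) Qa Pa = A1
  generalize bracket (H p) Qb (Pa ^ 2) = g
  generalize bracket (H p) Qb (Pa ^ 3) = k
  generalize bracket (H p) Qa (Pa ^ 2) = B1
  generalize bracket (H p) (Qa ^ 2) Pa = C1
  generalize bracket (H p) Qb Pb = A2
  generalize bracket (H p) (Qb ^ 2) Pb = C2
  generalize bracket (H p) Qb (Pb ^ 2) = B2
  generalize bracket (H p) (Qb ^ 2) Pa = m
  generalize bracket (H p) (Qb ^ 3) Pa = n
  generalize Complex.I = i at hI ⊢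
  -- This is the only use of `D * δ = 1` in the final identity: it exposes the common factor `D` of
  -- `ψ` and its derivatives.
  have h1 : (1 : ℂ) + D * f = D * (f + δ) := by rw [mul_add, hDδ]; ring
  rw [h1]
  -- Every term except the one from `h/4` in the potential carries a factor `i²`, so `i² = -1` is
  -- needed only for the `h` terms.
  linear_combination (A * e * D * (f + δ) * h / 2) * hI

end IsLax

end Lax

/-! ### The equation for the potential -/

section Lax

variable {ι : Type} [Fintype ι] [DecidableEq ι]
variable {a b κ₁ κ₂ : ℝ} {u v : ι → ℂ} {H : Pt → Matrix ι ι ℂ}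

/-- No differentiability of `g` is required, because `deriv` commutes with adding a constant and
with multiplying by one unconditionally. This allows `g = |ψ|²` without a separate smoothness proof.
-/
theorem lineDeriv_affine {U : Set Pt} (hU : IsOpen U) {f g : Pt → ℂ} {c k : ℂ}
    (h : ∀ p ∈ U, f p = c + k * g p) (e : Pt) :
    ∀ p ∈ U, lineDeriv ℝ f p e = k * lineDeriv ℝ g p e := by
  intro p hp
  rw [lineDeriv_congr_of_isOpen hU h e p hp]
  simp only [lineDeriv]
  rw [deriv_const_add, deriv_const_mul_field]

theorem lineDeriv_lineDeriv_affine {U : Set Pt} (hU : IsOpen U) {f g : Pt → ℂ} {c k : ℂ}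
    (h : ∀ p ∈ U, f p = c + k * g p) (e : Pt) {p : Pt} (hp : p ∈ U) :
    lineDeriv ℝ (fun q => lineDeriv ℝ f q e) p e =
      k * lineDeriv ℝ (fun q => lineDeriv ℝ g q e) p e :=
  lineDeriv_affine hU (c := 0) (fun q hq => by rw [lineDeriv_affine hU h e q hq, zero_add]) e p hp

/-- Exchanging partial derivatives gives `X₁₂ = Q₁`, hence `X₁₂₁ = Q₁₁`, and likewise `Y₂₂₁ = Q₂₂`.
The mixed derivative of `φ` thus becomes half the sum of the pure second derivatives of `Q`. -/
theorem mixed_deriv_potential {U : Set Pt} (hU : IsOpen U) {X Y Q φ : Pt → ℂ} {c : ℂ} {e₁ e₂ : Pt}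
    (hX : ContDiffOn ℝ ((⊤ : ℕ∞) : WithTop ℕ∞) X U)
    (hY : ContDiffOn ℝ ((⊤ : ℕ∞) : WithTop ℕ∞) Y U)
    (hXQ : ∀ p ∈ U, lineDeriv ℝ X p e₂ = Q p) (hYQ : ∀ p ∈ U, lineDeriv ℝ Y p e₁ = Q p)
    (hφ : ∀ p ∈ U, φ p = 1 / 2 * lineDeriv ℝ X p e₁ + 1 / 2 * lineDeriv ℝ Y p e₂ + c)
    {p : Pt} (hp : p ∈ U) :
    lineDeriv ℝ (fun q => lineDeriv ℝ φ q e₂) p e₁ =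
      1 / 2 * (lineDeriv ℝ (fun q => lineDeriv ℝ Q q e₁) p e₁ +
        lineDeriv ℝ (fun q => lineDeriv ℝ Q q e₂) p e₂) := by
  have hX1 := contDiffOn_lineDeriv hU hX e₁
  have hY2 := contDiffOn_lineDeriv hU hY e₂
  have h1 : ∀ q ∈ U, lineDeriv ℝ φ q e₂ =
      1 / 2 * lineDeriv ℝ Q q e₁ + 1 / 2 * lineDeriv ℝ (fun x => lineDeriv ℝ Y x e₂) q e₂ := by
    intro q hq
    have h2 : lineDeriv ℝ (fun x => lineDeriv ℝ X x e₁) q e₂ = lineDeriv ℝ Q q e₁ := by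
      rw [lineDeriv_comm hU hX e₁ e₂ hq]
      exact lineDeriv_congr_of_isOpen hU hXQ e₁ q hq
    rw [← h2]
    refine HasLineDerivAt.lineDeriv (HasLineDerivAt.congr_of_isOpen hU hq (fun x hx => ?_)
      ((((hasLineDerivAt_of_contDiffOn hU hX1 hq e₂).fun_const_mul (1 / 2)).fun_add
      ((hasLineDerivAt_of_contDiffOn hU hY2 hq e₂).fun_const_mul (1 / 2))).fun_const_add c))
    rw [hφ x hx]; ring
  have hQ : ContDiffOn ℝ ((⊤ : ℕ∞) : WithTop ℕ∞) Q U :=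
    (contDiffOn_lineDeriv hU hX e₂).congr fun q hq => (hXQ q hq).symm
  have h3 : lineDeriv ℝ (fun x => lineDeriv ℝ (fun x => lineDeriv ℝ Y x e₂) x e₂) p e₁ =
      lineDeriv ℝ (fun x => lineDeriv ℝ Q x e₂) p e₂ := by
    rw [lineDeriv_comm hU hY2 e₂ e₁ hp]
    refine lineDeriv_congr_of_isOpen hU (fun q hq => ?_) e₂ p hp
    rw [lineDeriv_comm hU hY e₂ e₁ hq]
    exact lineDeriv_congr_of_isOpen hU hYQ e₂ q hq
  rw [← h3, mul_add]
  exact HasLineDerivAt.lineDeriv (HasLineDerivAt.congr_of_isOpen hU hp h1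
      (((hasLineDerivAt_of_contDiffOn hU (contDiffOn_lineDeriv hU hQ e₁) hp e₁).fun_const_mul
        (1 / 2)).fun_add
      ((hasLineDerivAt_of_contDiffOn hU (contDiffOn_lineDeriv hU hY2 e₂) hp e₁).fun_const_mul
        (1 / 2))))

namespace IsLax

/-- The functions attached to a matrix that evolves by the flows solve DS1 as soon as they satisfy
the reality conditions. -/
theorem isDS1SolutionOn (hL : IsLax a b κ₁ κ₂ u v H) {A : ℂ} {ψ φ : Pt → ℂ} {h ρ : ℝ}
    {U : Set Pt} (hU : U = {p | (H p).det ≠ 0})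
    (hψ : ∀ p ∈ U, ψ p = A * (detRatio a b u v (H p) *
      Complex.exp (-Complex.I * (planePhase a b κ₁ κ₂ h p : ℂ))))
    (hφ : ∀ p ∈ U, φ p = phiBracket a b κ₁ κ₂ h u v (H p))
    (hreal : ∀ p ∈ U, (φ p).im = 0)
    (hnorm : ∀ p ∈ U, (ρ : ℂ) * normSqFun ψ p = -((κ₁ : ℂ) * κ₂ / ((a : ℂ) - b) ^ 2) *
      (detRatio a b u v (H p) * detRatio b a u v (H p))) :
    IsDS1SolutionOn ρ ψ φ U := by
  subst hU
  have hbr := fun q r => contDiffOn_bracket hL.smooth q r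
  refine ⟨hL.isOpen, ?_, ?_, hreal, fun p hp => hL.schrodinger hψ hφ hp, fun p hp => ?_⟩
  · refine ContDiffOn.congr ?_ hψ
    exact contDiffOn_const.mul ((contDiffOn_const.add (contDiffOn_const.mul (hbr _ _))).mul
      (contDiff_planeWave a b κ₁ κ₂ h).contDiffOn)
  · exact (hL.contDiffOn_phiBracket h).congr hφ
  -- By the reality hypothesis, the common value of the two cross derivatives is `-ρ|ψ|²` up to an
  -- additive constant, which second derivatives do not see.
  · have hQ : ∀ q ∈ {p | (H p).det ≠ 0}, (κ₁ : ℂ) * κ₂ / ((a : ℂ) - b) ^ 2 *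
        (detRatio a b u v (H q) * detRatio b a u v (H q) - 1) =
        -((κ₁ : ℂ) * κ₂ / ((a : ℂ) - b) ^ 2) + (-(ρ : ℂ)) * normSqFun ψ q := by
      intro q hq
      rw [neg_mul, hnorm q hq]
      ring
    have hD := hL.a_ne_b_cast
    have hD' : (a : ℂ) - b ≠ 0 := by rw [← neg_sub]; exact neg_ne_zero.mpr hD
    -- With `D = b - a`, `1 - (1 + D f)(1 - D g) = -D (f - g) + D² f g`. The cross derivative is
    -- therefore a product of two quotients of determinants, minus one.
    have alg : ∀ f g : ℂ, Complex.I * κ₁ * (-(Complex.I * κ₂) *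
        (1 / ((b : ℂ) - a) * (f - g) - f * g)) = (κ₁ : ℂ) * κ₂ / ((a : ℂ) - b) ^ 2 *
        ((1 + ((b : ℂ) - a) * f) * (1 + ((a : ℂ) - b) * g) - 1) := by
      intro f g
      have h1 : ∀ X : ℂ, Complex.I * κ₁ * (-(Complex.I * κ₂) * X) = κ₁ * κ₂ * X := fun X => by
        linear_combination (-(κ₁ * κ₂ * X) : ℂ) * Complex.I_sq
      rw [h1, ← neg_sub (b : ℂ) a]
      field_simp
      ring
    have hXQ : ∀ q ∈ {p | (H p).det ≠ 0}, lineDeriv ℝ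
        (fun x => Complex.I * κ₁ * bracket (H x) (resolvent a u) (resolvent a v)) q (0, 1, 0) =
        (κ₁ : ℂ) * κ₂ / ((a : ℂ) - b) ^ 2 *
        (detRatio a b u v (H q) * detRatio b a u v (H q) - 1) := by
      intro q hq
      rw [((hL.bracket_eta_mixed hq).fun_const_mul (Complex.I * κ₁)).lineDeriv, detRatio, detRatio]
      exact alg _ _
    have hYQ : ∀ q ∈ {p | (H p).det ≠ 0}, lineDeriv ℝ
        (fun x => -(Complex.I * κ₂) * bracket (H x) (resolvent b u) (resolvent b v)) q (1, 0, 0) =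
        (κ₁ : ℂ) * κ₂ / ((a : ℂ) - b) ^ 2 *
        (detRatio a b u v (H q) * detRatio b a u v (H q) - 1) := by
      intro q hq
      rw [((hL.bracket_xi_mixed hq).fun_const_mul (-(Complex.I * κ₂))).lineDeriv, detRatio,
        detRatio]
      rw [← alg]
      ring
    have hφ' : ∀ q ∈ {p | (H p).det ≠ 0}, φ q =
        1 / 2 * lineDeriv ℝ
          (fun x => Complex.I * κ₁ * bracket (H x) (resolvent a u) (resolvent a v)) q (1, 0, 0) +
        1 / 2 * lineDeriv ℝ
          (fun x => -(Complex.I * κ₂) * bracket (H x) (resolvent b u) (resolvent b v)) q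
          (0, 1, 0) + (h : ℂ) / 4 := by
      intro q hq
      rw [((hL.bracket_xi hq (resolvent a u) (resolvent a v)).fun_const_mul _).lineDeriv,
        ((hL.bracket_eta hq (resolvent b u) (resolvent b v)).fun_const_mul _).lineDeriv, hφ q hq,
        phiBracket]
      simp only [← pow_two]
    have key := mixed_deriv_potential hL.isOpen (contDiffOn_const.mul (hbr _ _))
      (contDiffOn_const.mul (hbr _ _)) hXQ hYQ hφ' hp
    rw [lineDeriv_lineDeriv_affine hL.isOpen hQ (1, 0, 0) hp,
      lineDeriv_lineDeriv_affine hL.isOpen hQ (0, 1, 0) hp] at key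
    simp only [dXi_eq_lineDeriv, dEta_eq_lineDeriv]
    rw [key]
    ring

end IsLax

end Lax

/-! ### Reality of the potential and the sign `ρ` -/

section Reality

theorem amplitude_ne_zero {a b κ₁ κ₂ : ℝ} (θ : ℝ) (hab : a ≠ b) (h₁ : κ₁ ≠ 0) (h₂ : κ₂ ≠ 0) :
    amplitude a b κ₁ κ₂ θ ≠ 0 := by
  refine mul_ne_zero ?_ (Complex.exp_ne_zero _)
  have h3 : |κ₁ * κ₂| > 0 := abs_pos.mpr (mul_ne_zero h₁ h₂)
  have h4 : |a - b| > 0 := abs_pos.mpr (sub_ne_zero.mpr hab)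
  exact_mod_cast (by positivity : Real.sqrt |κ₁ * κ₂| * |a - b|⁻¹ ≠ 0)

theorem amplitude_mul_conj (a b κ₁ κ₂ θ : ℝ) :
    amplitude a b κ₁ κ₂ θ * (starRingEnd ℂ) (amplitude a b κ₁ κ₂ θ) =
      ((|κ₁ * κ₂| / (a - b) ^ 2 : ℝ) : ℂ) := by
  have h1 : (starRingEnd ℂ) (Complex.exp (Complex.I * θ)) = Complex.exp (-(Complex.I * θ)) := by
    rw [← Complex.exp_conj]; simp
  have h2 : Complex.exp (Complex.I * θ) * Complex.exp (-(Complex.I * θ)) = 1 := by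
    rw [← Complex.exp_add]; simp
  have h3 : (Real.sqrt |κ₁ * κ₂| * |a - b|⁻¹) * (Real.sqrt |κ₁ * κ₂| * |a - b|⁻¹) =
      |κ₁ * κ₂| / (a - b) ^ 2 := by
    rw [mul_mul_mul_comm, Real.mul_self_sqrt (abs_nonneg _), ← mul_inv, ← pow_two, sq_abs]
    rfl
  rw [amplitude, map_mul, h1, Complex.conj_ofReal, mul_mul_mul_comm, h2, mul_one,
    ← Complex.ofReal_mul, h3]

theorem rho_mul_abs (κ₁ κ₂ : ℝ) : rho κ₁ κ₂ * |κ₁ * κ₂| = -(κ₁ * κ₂) := by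
  rw [rho, neg_mul]
  rcases lt_trichotomy (κ₁ * κ₂) 0 with h | h | h
  · rw [Real.sign_of_neg h, abs_of_neg h]; ring
  · rw [h]; simp
  · rw [Real.sign_of_pos h, abs_of_pos h]; ring

/-- The reality condition `ψ* = ρ ψ̄`, given the conjugation symmetry of the quotients of
determinants. -/
theorem psiStar_eq_of_conj {a b κ₁ κ₂ : ℝ} (θ : ℝ) (hab : a ≠ b) (h₁ : κ₁ ≠ 0) (h₂ : κ₂ ≠ 0)
    {R R' : ℂ} (hR : (starRingEnd ℂ) R = R') (x : ℝ) :
    -((κ₁ : ℂ) * κ₂ / (amplitude a b κ₁ κ₂ θ * ((a : ℂ) - b) ^ 2)) * R' *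
        Complex.exp (Complex.I * (x : ℂ)) =
      (rho κ₁ κ₂ : ℂ) * (starRingEnd ℂ)
        (amplitude a b κ₁ κ₂ θ * R * Complex.exp (-Complex.I * (x : ℂ))) := by
  have hA := amplitude_ne_zero θ hab h₁ h₂
  have hD : (a : ℂ) - b ≠ 0 := sub_ne_zero.mpr (by exact_mod_cast hab)
  have h3 : (starRingEnd ℂ) (Complex.exp (-Complex.I * (x : ℂ))) =
      Complex.exp (Complex.I * (x : ℂ)) := by
    rw [← Complex.exp_conj]; simp
  -- The prefactor of `ψ*` is `ρ` times the conjugate amplitude, because `|A|² (a - b)² = |κ₁κ₂|`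
  -- and `ρ |κ₁κ₂| = -κ₁κ₂`. This fixes both the modulus of the amplitude and the sign `ρ`.
  have h4 : -((κ₁ : ℂ) * κ₂ / (amplitude a b κ₁ κ₂ θ * ((a : ℂ) - b) ^ 2)) =
      (rho κ₁ κ₂ : ℂ) * (starRingEnd ℂ) (amplitude a b κ₁ κ₂ θ) := by
    have h5 := amplitude_mul_conj a b κ₁ κ₂ θ
    have h6 : ((rho κ₁ κ₂ : ℝ) : ℂ) * ((|κ₁ * κ₂| : ℝ) : ℂ) = -(κ₁ * κ₂) := by
      rw [← Complex.ofReal_mul, rho_mul_abs]; push_cast; ring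
    push_cast at h5
    field_simp at h5 ⊢
    linear_combination -h6 - (rho κ₁ κ₂ : ℂ) * h5
  rw [map_mul, map_mul, hR, h3, h4]
  ring

theorem rho_mul_normSqFun {ρ : ℂ} {ψ : Pt → ℂ} {p : Pt} {w : ℂ}
    (h : w = ρ * (starRingEnd ℂ) (ψ p)) : ρ * normSqFun ψ p = ψ p * w := by
  rw [h, normSqFun, ← Complex.normSq_eq_norm_sq, Complex.normSq_eq_conj_mul_self]
  ring

theorem conj_lineDeriv_of_conj_eq {f : Pt → ℂ} (hf : ∀ q, (starRingEnd ℂ) (f q) = f q) (e q : Pt) :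
    (starRingEnd ℂ) (lineDeriv ℝ f q e) = lineDeriv ℝ f q e := by
  have h := (deriv.star (f := fun t : ℝ => f (q + t • e)) (x := (0 : ℝ))).symm
  simp only [lineDeriv, starRingEnd_apply] at hf h ⊢
  rw [h]
  simp only [hf]

theorem phiOf_im_eq_zero {F : Pt → ℂ} (hF : ∀ q, (starRingEnd ℂ) (F q) = F q) (h : ℝ) (p : Pt) :
    (phiOf F h p).im = 0 := by
  rw [← Complex.conj_eq_iff_im]
  -- This holds also at the zeros of `F`, where the quotient is `0` by convention, so the functions
  -- being differentiated are real on the whole space.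
  have h1 : ∀ q, (starRingEnd ℂ) (dXi F q / F q) = dXi F q / F q := fun q => by
    rw [map_div₀, hF, dXi_eq_lineDeriv, conj_lineDeriv_of_conj_eq hF]
  have h2 : ∀ q, (starRingEnd ℂ) (dEta F q / F q) = dEta F q / F q := fun q => by
    rw [map_div₀, hF, dEta_eq_lineDeriv, conj_lineDeriv_of_conj_eq hF]
  have h3 := conj_lineDeriv_of_conj_eq h1 (1, 0, 0) p
  have h4 := conj_lineDeriv_of_conj_eq h2 (0, 1, 0) p
  simp only [phiOf, map_add, map_mul, map_div₀]
  rw [dXi_eq_lineDeriv (fun q => dXi F q / F q), dEta_eq_lineDeriv (fun q => dEta F q / F q),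
    h3, h4]
  simp [Complex.conj_ofNat]

end Reality

/-! ### Rank-one perturbations of determinants -/

section Shift

variable {ι : Type} [Fintype ι] [DecidableEq ι]

/-- Used with `L` and `M` the matrices for parameters `0` and `β`: diagonal scalings on both sides
make them differ by rank one. -/
theorem det_mul_prod_eq_of_rank_one {L M : Matrix ι ι ℂ} (hL : L.det ≠ 0) {S T x y : ι → ℂ}
    {c : ℂ} (h : ∀ i j, S i * M i j * T j = L i j + c * (x i * y j)) :
    M.det * ∏ i, (S i * T i) = L.det * (1 + c * bracket L y x) := by
  have h1 : Matrix.diagonal S * M * Matrix.diagonal T = L + c • Matrix.vecMulVec x y := by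
    ext i j
    simp [Matrix.vecMulVec_apply, h]
  have h2 := congrArg Matrix.det h1
  rw [det_add_smul_vecMulVec hL, Matrix.det_mul, Matrix.det_mul, Matrix.det_diagonal,
    Matrix.det_diagonal] at h2
  rw [Finset.prod_mul_distrib, bracket, ← h2]
  ring

end Shift

/-! ### Determinantal solutions in general position -/

namespace DetData

variable {ι : Type} (P : DetData ι)

/-- The general position conditions on the data of a determinantal solution. -/
structure IsGeneric : Prop where
  wa_ne_wb : P.wa ≠ P.wb
  v_ne_u : ∀ i k, P.v i ≠ P.u k
  wa_ne_u : ∀ i, (P.wa : ℂ) ≠ P.u i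
  wa_ne_v : ∀ i, (P.wa : ℂ) ≠ P.v i
  wb_ne_u : ∀ i, (P.wb : ℂ) ≠ P.u i
  wb_ne_v : ∀ i, (P.wb : ℂ) ≠ P.v i

/-- The matrix `diag (e^{-z_i} / (v_i - u_i)) + (1 / (v_i - u_k))`. -/
noncomputable def laxMatrix [DecidableEq ι] (β : ℂ) (p : Pt) : Matrix ι ι ℂ := Matrix.of fun i k =>
  (if i = k then Complex.exp (-P.z β p i) / (P.v i - P.u i) else 0) + 1 / (P.v i - P.u k)

/-- Only integer multiples of `r_k` are exponentiated, so the branch of the logarithm plays no role.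
-/
theorem exp_mul_r {P : DetData ι} (hP : P.IsGeneric) (n : ℤ) (k : ι) :
    Complex.exp (n * P.r k) = (((P.wb : ℂ) - P.v k) / ((P.wb : ℂ) - P.u k) *
    (((P.wa : ℂ) - P.u k) / ((P.wa : ℂ) - P.v k))) ^ n := by
  rw [Complex.exp_int_mul, r, Complex.exp_log]
  have h1 := sub_ne_zero.mpr (hP.wa_ne_u k)
  have h2 := sub_ne_zero.mpr (hP.wa_ne_v k)
  have h3 := sub_ne_zero.mpr (hP.wb_ne_u k)
  have h4 := sub_ne_zero.mpr (hP.wb_ne_v k)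
  positivity

theorem z_hasLineDerivAt (β : ℂ) (p : Pt) (k : ι) :
    HasLineDerivAt ℝ (fun x => P.z β x k) (Complex.I * P.κ₁ * P.V P.wa k) p (1, 0, 0) ∧
    HasLineDerivAt ℝ (fun x => P.z β x k) (-(Complex.I * P.κ₂ * P.V P.wb k)) p (0, 1, 0) ∧
    HasLineDerivAt ℝ (fun x => P.z β x k) (Complex.I * ((P.κ₁ : ℂ) ^ 2 * P.W P.wa k
      - (P.κ₂ : ℂ) ^ 2 * P.W P.wb k) / 2) p (0, 0, 1) := by
  have key : ∀ (e : Pt) (c : ℂ), (∀ t : ℝ, P.z β (p + t • e) k = P.z β p k + t * c) →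
      HasLineDerivAt ℝ (fun x => P.z β x k) c p e := by
    intro e c hc
    have h1 := ((Complex.ofRealCLM.hasDerivAt (x := (0 : ℝ))).mul_const c).const_add (P.z β p k)
    simp only [Complex.ofRealCLM_apply, Complex.ofReal_one, one_mul] at h1
    refine HasDerivAt.congr_of_eventuallyEq h1 (Eventually.of_forall fun t => ?_)
    exact hc t
  refine ⟨key _ _ fun t => ?_, key _ _ fun t => ?_, key _ _ fun t => ?_⟩ <;>
  · simp [z, Z]
    ring

theorem contDiff_z {n : WithTop ℕ∞} (β : ℂ) (k : ι) : ContDiff ℝ n fun p => P.z β p k := by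
  have h1 : ContDiff ℝ n fun p : Pt => (p.1 : ℂ) :=
    Complex.ofRealCLM.contDiff.comp contDiff_fst
  have h2 : ContDiff ℝ n fun p : Pt => (p.2.1 : ℂ) :=
    Complex.ofRealCLM.contDiff.comp (contDiff_fst.comp contDiff_snd)
  have h3 : ContDiff ℝ n fun p : Pt => (p.2.2 : ℂ) :=
    Complex.ofRealCLM.contDiff.comp (contDiff_snd.comp contDiff_snd)
  unfold z Z
  exact ((((contDiff_const.mul h1).sub (contDiff_const.mul h2)).add
    (contDiff_const.mul (h3.div_const 2))).sub contDiff_const).add contDiff_const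

theorem contDiff_laxMatrix [DecidableEq ι] {n : WithTop ℕ∞} (β : ℂ) (i j : ι) :
    ContDiff ℝ n fun p => P.laxMatrix β p i j := by
  by_cases hij : i = j
  · simp only [laxMatrix, Matrix.of_apply, hij, if_true]
    exact ((P.contDiff_z β j).neg.cexp.div_const _).add contDiff_const
  · simp only [laxMatrix, Matrix.of_apply, hij, if_false]
    exact contDiff_const

theorem laxMatrix_hasLineDerivAt [DecidableEq ι] {β : ℂ} {p e : Pt} {c : ι → ℂ}
    (hc : ∀ k, HasLineDerivAt ℝ (fun x => P.z β x k) (c k) p e) (i j : ι) :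
    HasLineDerivAt ℝ (fun x => P.laxMatrix β x i j)
      (if i = j then -(c i) * (Complex.exp (-P.z β p i) / (P.v i - P.u i)) else 0) p e := by
  by_cases hij : i = j
  · subst hij
    simp only [laxMatrix, Matrix.of_apply, if_true]
    convert ((((hc i).fun_const_mul (-1)).fun_cexp).fun_const_mul
      (1 / (P.v i - P.u i))).fun_const_add (1 / (P.v i - P.u i)) using 1
    · funext x; ring_nf
    · ring_nf
  · simp only [laxMatrix, Matrix.of_apply, hij, if_false]
    exact hasDerivAt_const (0 : ℝ) (0 + 1 / (P.v i - P.u j))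

/-- For `x = 1/(c - v_i)` and `y = 1/(c - u_k)` one has `x - y = (v_i - u_k) x y`, so both flows
annihilate the Cauchy part. On the diagonal of exponentials they act by the scalars `-V` and `-W`,
which are the rates of `e^{-z_i}`. -/
theorem isLax [Fintype ι] [DecidableEq ι] {P : DetData ι} (hP : P.IsGeneric) (β : ℂ) :
    IsLax P.wa P.wb P.κ₁ P.κ₂ P.u P.v (P.laxMatrix β) := by
  refine ⟨hP.wa_ne_wb, hP.wa_ne_u, hP.wa_ne_v, hP.wb_ne_u, hP.wb_ne_v,
    P.contDiff_laxMatrix β, ?_, ?_, ?_⟩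
  all_goals
    intro p i j
    have h1 := sub_ne_zero.mpr (hP.wa_ne_u j)
    have h2 := sub_ne_zero.mpr (hP.wa_ne_v i)
    have h3 := sub_ne_zero.mpr (hP.wb_ne_u j)
    have h4 := sub_ne_zero.mpr (hP.wb_ne_v i)
    have h5 := sub_ne_zero.mpr (hP.v_ne_u i j)
  · convert P.laxMatrix_hasLineDerivAt (fun k => (P.z_hasLineDerivAt β p k).1) i j using 1
    simp only [Matrix.smul_apply, flowOne_apply, resolvent, laxMatrix, Matrix.of_apply,
      smul_eq_mul, V]
    split_ifs with hij
    · subst hij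
      field_simp
      ring
    · field_simp
      ring
  · convert P.laxMatrix_hasLineDerivAt (fun k => (P.z_hasLineDerivAt β p k).2.1) i j using 1
    simp only [Matrix.smul_apply, flowOne_apply, resolvent, laxMatrix, Matrix.of_apply,
      smul_eq_mul, V]
    split_ifs with hij
    · subst hij
      field_simp
      ring
    · field_simp
      ring
  · convert P.laxMatrix_hasLineDerivAt (fun k => (P.z_hasLineDerivAt β p k).2.2) i j using 1
    simp only [Matrix.smul_apply, Matrix.sub_apply, flowTwo_apply, resolvent, laxMatrix,
      Matrix.of_apply, smul_eq_mul, W]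
    split_ifs with hij
    · subst hij
      field_simp
      ring
    · field_simp
      ring

end DetData

namespace DetData

section General

variable {ι : Type} [Fintype ι] [DecidableEq ι]

/-- The factor between `det 𝕋_β` and the determinant of the matrix `laxMatrix`. -/
noncomputable def gauge (P : DetData ι) (β : ℂ) (p : Pt) : ℂ :=
  ∏ i, ((P.v i - P.u i) * Complex.exp (P.z β p i))

omit [DecidableEq ι] in
theorem gauge_ne_zero {P : DetData ι} (hP : ∀ i k, P.v i ≠ P.u k) (β : ℂ) (p : Pt) :
    P.gauge β p ≠ 0 :=
  Finset.prod_ne_zero_iff.mpr fun i _ =>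
    mul_ne_zero (sub_ne_zero.mpr (hP i i)) (Complex.exp_ne_zero _)

/-- `𝕋_β` is `laxMatrix` with row `i` scaled by `(v_i - u_i) e^{z_i/2}` and column `k` by
`e^{z_k/2}`. -/
theorem detT_eq {P : DetData ι} (hP : ∀ i k, P.v i ≠ P.u k) (β : ℂ) (p : Pt) :
    P.detT β p = P.gauge β p * (P.laxMatrix β p).det := by
  have h1 : P.T β p =
      Matrix.diagonal (fun i => (P.v i - P.u i) * Complex.exp (1 / 2 * P.z β p i)) *
        P.laxMatrix β p * Matrix.diagonal (fun i => Complex.exp (1 / 2 * P.z β p i)) := by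
    ext i k
    have h5 := sub_ne_zero.mpr (hP i k)
    simp only [T, laxMatrix, Matrix.of_apply, Matrix.mul_diagonal, Matrix.diagonal_mul, mul_add,
      Complex.exp_add]
    split_ifs with hik
    · subst hik
      have h6 : Complex.exp (1 / 2 * P.z β p i) * Complex.exp (1 / 2 * P.z β p i) *
          Complex.exp (-P.z β p i) = 1 := by
        rw [← Complex.exp_add, ← Complex.exp_add]; ring_nf; simp
      field_simp at h6 ⊢
      linear_combination -h6
    · field_simp
      ring
  rw [detT, h1, Matrix.det_mul, Matrix.det_mul, Matrix.det_diagonal, Matrix.det_diagonal, gauge,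
    mul_right_comm, ← Finset.prod_mul_distrib]
  congr 1
  refine Finset.prod_congr rfl fun i _ => ?_
  rw [mul_assoc, ← Complex.exp_add]
  ring_nf

theorem detT_ne_zero_iff {P : DetData ι} (hP : ∀ i k, P.v i ≠ P.u k) (β : ℂ) (p : Pt) :
    P.detT β p ≠ 0 ↔ (P.laxMatrix β p).det ≠ 0 := by
  rw [detT_eq hP, mul_ne_zero_iff]
  simp [gauge_ne_zero hP]

omit [Fintype ι] [DecidableEq ι] in
theorem exp_z_shift (P : DetData ι) (β : ℂ) (p : Pt) (i : ι) :
    Complex.exp (P.z β p i) = Complex.exp (P.z 0 p i) * Complex.exp (β * P.r i) := by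
  rw [← Complex.exp_add]
  simp [z]

/-- The identity `(b - v)(a - u) - (a - v)(b - u) = (b - a)(v - u)` shows that scaling rows by `(b -
v)/(a - v)` and columns by `(a - u)/(b - u)` changes the Cauchy part by rank one. The same scalings
undo the effect of `e^{β r}` on the diagonal. -/
theorem detT_shift {P : DetData ι} (hP : P.IsGeneric) {β : ℂ} {a b : ℝ}
    (ha_u : ∀ i, (a : ℂ) ≠ P.u i) (ha_v : ∀ i, (a : ℂ) ≠ P.v i)
    (hb_u : ∀ i, (b : ℂ) ≠ P.u i) (hb_v : ∀ i, (b : ℂ) ≠ P.v i)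
    (hr : ∀ i, Complex.exp (β * P.r i) = ((b : ℂ) - P.v i) / ((a : ℂ) - P.v i) *
      (((a : ℂ) - P.u i) / ((b : ℂ) - P.u i))) {p : Pt} (hp : P.detT 0 p ≠ 0) :
    P.detT β p = P.detT 0 p * detRatio a b P.u P.v (P.laxMatrix 0 p) := by
  have hL := (detT_ne_zero_iff hP.v_ne_u 0 p).mp hp
  have h1 := det_mul_prod_eq_of_rank_one hL (M := P.laxMatrix β p)
    (S := fun i => ((b : ℂ) - P.v i) / ((a : ℂ) - P.v i))
    (T := fun i => ((a : ℂ) - P.u i) / ((b : ℂ) - P.u i))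
    (x := resolvent a P.v) (y := resolvent b P.u) (c := (b : ℂ) - a) (fun i j => by
      have h1 := sub_ne_zero.mpr (ha_u j)
      have h2 := sub_ne_zero.mpr (ha_v i)
      have h3 := sub_ne_zero.mpr (hb_u j)
      have h4 := sub_ne_zero.mpr (hb_v i)
      have h5 := sub_ne_zero.mpr (hP.v_ne_u i j)
      have hz : Complex.exp (-P.z β p i) = Complex.exp (-P.z 0 p i) *
          (((b : ℂ) - P.v i) / ((a : ℂ) - P.v i) * (((a : ℂ) - P.u i) / ((b : ℂ) - P.u i)))⁻¹ := by
        rw [Complex.exp_neg, exp_z_shift, mul_inv, hr, Complex.exp_neg]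
      simp only [laxMatrix, Matrix.of_apply, resolvent, hz]
      split_ifs with hij
      · subst hij
        field_simp
        ring
      · field_simp
        ring)
  have h2 : P.gauge β p = P.gauge 0 p * ∏ i, (((b : ℂ) - P.v i) / ((a : ℂ) - P.v i) *
      (((a : ℂ) - P.u i) / ((b : ℂ) - P.u i))) := by
    rw [gauge, gauge, ← Finset.prod_mul_distrib]
    refine Finset.prod_congr rfl fun i _ => ?_
    rw [exp_z_shift, hr, mul_assoc]
  rw [detT_eq hP.v_ne_u, detT_eq hP.v_ne_u, h2, detRatio, mul_assoc, mul_assoc, ← h1]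
  ring

theorem detT_one {P : DetData ι} (hP : P.IsGeneric) {p : Pt} (hp : P.detT 0 p ≠ 0) :
    P.detT 1 p = P.detT 0 p * detRatio P.wa P.wb P.u P.v (P.laxMatrix 0 p) := by
  refine detT_shift hP hP.wa_ne_u hP.wa_ne_v hP.wb_ne_u hP.wb_ne_v (fun i => ?_) hp
  have := exp_mul_r hP 1 i
  rw [Int.cast_one] at this
  rw [this, zpow_one]
  ring

theorem detT_neg_one {P : DetData ι} (hP : P.IsGeneric) {p : Pt} (hp : P.detT 0 p ≠ 0) :
    P.detT (-1) p = P.detT 0 p * detRatio P.wb P.wa P.u P.v (P.laxMatrix 0 p) := by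
  refine detT_shift hP hP.wb_ne_u hP.wb_ne_v hP.wa_ne_u hP.wa_ne_v
    (fun i => ?_) hp
  have := exp_mul_r hP (-1) i
  rw [Int.cast_neg, Int.cast_one] at this
  rw [this, zpow_neg_one, mul_inv, inv_div, inv_div]
  ring

omit [DecidableEq ι] in
theorem gauge_hasLineDerivAt (P : DetData ι) {β : ℂ} {p e : Pt} {c : ι → ℂ}
    (hc : ∀ k, HasLineDerivAt ℝ (fun x => P.z β x k) (c k) p e) :
    HasLineDerivAt ℝ (P.gauge β) ((∑ k, c k) * P.gauge β p) p e := by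
  have h1 : P.gauge β = fun x => (∏ i, (P.v i - P.u i)) * Complex.exp (∑ i, P.z β x i) := by
    funext x
    rw [gauge, Finset.prod_mul_distrib, Complex.exp_sum]
  have h2 : HasLineDerivAt ℝ (fun x => ∑ i, P.z β x i) (∑ k, c k) p e :=
    HasDerivAt.fun_sum fun i _ => hc i
  rw [h1]
  convert (h2.fun_cexp).fun_const_mul (∏ i, (P.v i - P.u i)) using 1
  ring

/-- The functions `z_k` are affine in the coordinates, so the logarithmic derivatives of the gauge
factor are constant and do not affect the potential. -/
theorem phi_eq {P : DetData ι} (hP : P.IsGeneric) {p : Pt} (hp : P.detT 0 p ≠ 0) :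
    P.phi p = phiBracket P.wa P.wb P.κ₁ P.κ₂ P.h P.u P.v (P.laxMatrix 0 p) :=
  (isLax hP 0).phiOf_eq (detT_eq hP.v_ne_u 0) (gauge_ne_zero hP.v_ne_u 0)
    (fun p => P.gauge_hasLineDerivAt fun k => (P.z_hasLineDerivAt 0 p k).1)
    (fun p => P.gauge_hasLineDerivAt fun k => (P.z_hasLineDerivAt 0 p k).2.1) P.h
    ((detT_ne_zero_iff hP.v_ne_u 0 p).mp hp)

end General

/-! ### Conjugation symmetry of breathers -/

section Breather

variable {N : ℕ} {P : DetData (Fin N ⊕ Fin N)} (hP : P.IsBreather)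

include hP

theorem IsBreather.conj_v (i : Fin N ⊕ Fin N) : (starRingEnd ℂ) (P.v i) = P.u i.swap := by
  rcases i with i | i
  · exact hP.conj_v_odd i
  · exact hP.conj_v_even i

theorem IsBreather.conj_u (i : Fin N ⊕ Fin N) : (starRingEnd ℂ) (P.u i) = P.v i.swap := by
  rw [← Complex.conj_conj (P.v i.swap), hP.conj_v, Sum.swap_swap]

theorem IsBreather.conj_u_ne (i : Fin N ⊕ Fin N) : (starRingEnd ℂ) (P.u i) ≠ P.u i := by
  rw [hP.conj_u]
  exact hP.v_ne_u _ _

/-- Every `u_i` and `v_i` is non-real, because its conjugate is a point of the other family; the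
real poles `w_a`, `w_b` therefore avoid them. -/
theorem IsBreather.isGeneric : P.IsGeneric := by
  have hu : ∀ (c : ℝ) i, (c : ℂ) ≠ P.u i := fun c i h => hP.conj_u_ne i (by
    rw [← h, Complex.conj_ofReal])
  have hv : ∀ (c : ℝ) i, (c : ℂ) ≠ P.v i := fun c i h => hu c i.swap (by
    rw [← hP.conj_v, ← h, Complex.conj_ofReal])
  exact ⟨hP.wa_ne_wb, hP.v_ne_u, hu _, hv _, hu _, hv _⟩

theorem IsBreather.conj_V (c : ℝ) (k : Fin N ⊕ Fin N) :
    (starRingEnd ℂ) (P.V c k) = -P.V c k.swap := by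
  simp [V, hP.conj_u, hP.conj_v]

theorem IsBreather.conj_W (c : ℝ) (k : Fin N ⊕ Fin N) :
    (starRingEnd ℂ) (P.W c k) = -P.W c k.swap := by
  simp [W, hP.conj_u, hP.conj_v]

theorem IsBreather.conj_Z (p : Pt) (k : Fin N ⊕ Fin N) :
    (starRingEnd ℂ) (P.Z p k) = P.Z p k.swap := by
  simp [Z, hP.conj_V, hP.conj_W, Complex.conj_ofNat]
  ring

theorem IsBreather.exp_conj_d (k : Fin N ⊕ Fin N) :
    Complex.exp (-(starRingEnd ℂ) (P.d k)) = Complex.exp (-P.d k.swap) := by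
  rw [Complex.exp_eq_exp_iff_exists_int]
  rcases k with k | k
  · obtain ⟨m, hm⟩ := hP.conj_d k
    refine ⟨-m, ?_⟩
    rw [hm]
    simp only [Sum.swap_inl]
    push_cast
    ring
  · obtain ⟨m, hm⟩ := hP.conj_d k
    refine ⟨-m, ?_⟩
    have h1 := congrArg (starRingEnd ℂ) hm
    simp only [map_add, map_mul, Complex.conj_conj, Complex.conj_ofReal, Complex.conj_I,
      Complex.conj_ofNat, map_intCast] at h1
    simp only [Sum.swap_inr]
    rw [h1]
    push_cast
    ring

theorem IsBreather.conj_exp_r (n : ℤ) (k : Fin N ⊕ Fin N) :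
    (starRingEnd ℂ) (Complex.exp (n * P.r k)) = Complex.exp (-n * P.r k.swap) := by
  have h1 := exp_mul_r hP.isGeneric (-n) k.swap
  rw [Int.cast_neg] at h1
  rw [h1, exp_mul_r hP.isGeneric, zpow_neg, ← inv_zpow]
  simp only [map_zpow₀, map_mul, map_div₀, map_sub, Complex.conj_ofReal, hP.conj_u, hP.conj_v,
    mul_inv, inv_div]

theorem IsBreather.conj_exp_z (n : ℤ) (p : Pt) (k : Fin N ⊕ Fin N) :
    (starRingEnd ℂ) (Complex.exp (P.z n p k)) = Complex.exp (P.z (-n) p k.swap) := by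
  rw [z, z, Complex.exp_add, Complex.exp_add, sub_eq_add_neg, sub_eq_add_neg, Complex.exp_add,
    Complex.exp_add, map_mul, map_mul, hP.conj_exp_r, ← hP.exp_conj_d, ← Complex.exp_conj,
    ← Complex.exp_conj, hP.conj_Z, map_neg]

/-- The conjugation symmetry of the determinants. -/
theorem IsBreather.conj_detT (n : ℤ) (p : Pt) :
    (starRingEnd ℂ) (P.detT n p) = P.detT (-n) p := by
  have hswap : ∀ x : Fin N ⊕ Fin N, Equiv.sumComm (Fin N) (Fin N) x = x.swap := fun x => rfl
  -- Conjugation exchanges `u` and `v` with swapped indices, so `1/(v_i - u_k)` becomes `-1/(v_k' -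
  -- u_i')`: a transpose and a sign. The parameter changes sign because conjugation sends `e^{r_k}`
  -- to `e^{-r_k'}`.
  have h1 : ((P.laxMatrix n p).map (starRingEnd ℂ)) =
      (-(P.laxMatrix (-n) p).submatrix (Equiv.sumComm (Fin N) (Fin N))
        (Equiv.sumComm (Fin N) (Fin N))).transpose := by
    ext i k
    simp only [laxMatrix, Matrix.map_apply, Matrix.of_apply, Matrix.transpose_apply,
      Matrix.neg_apply, Matrix.submatrix_apply, hswap, map_add, map_div₀, map_sub, map_one,
      hP.conj_u, hP.conj_v]
    have h2 := sub_ne_zero.mpr (hP.v_ne_u k.swap i.swap)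
    by_cases hik : i = k
    · subst hik
      simp only [if_true, map_div₀, map_sub, hP.conj_u, hP.conj_v, Complex.exp_neg, map_inv₀,
        hP.conj_exp_z]
      rw [← neg_sub (P.v i.swap)]
      field_simp
      ring
    · have hik' : k.swap ≠ i.swap := fun h => hik (Sum.swap_leftInverse.injective h).symm
      simp only [hik, hik', if_false, map_zero]
      rw [← neg_sub (P.v k.swap)]
      field_simp
      ring
  have h3 : (starRingEnd ℂ) (P.gauge n p) =
      (-1) ^ Fintype.card (Fin N ⊕ Fin N) * P.gauge (-n) p := by
    rw [gauge, gauge, map_prod, ← (Equiv.sumComm (Fin N) (Fin N)).prod_comp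
      (fun i => (P.v i - P.u i) * Complex.exp (P.z (-n) p i)), ← Finset.card_univ,
      ← Finset.prod_const, ← Finset.prod_mul_distrib]
    refine Finset.prod_congr rfl fun i _ => ?_
    rw [map_mul, hP.conj_exp_z, map_sub, hP.conj_u, hP.conj_v, hswap]
    ring
  have h4 : (starRingEnd ℂ) (P.laxMatrix n p).det =
      (-1) ^ Fintype.card (Fin N ⊕ Fin N) * (P.laxMatrix (-n) p).det := by
    rw [RingHom.map_det, RingHom.mapMatrix_apply, h1, Matrix.det_transpose, Matrix.det_neg,
      Matrix.det_submatrix_equiv_self]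
  -- The gauge and the determinant each contribute a sign to the power of the size, and the two
  -- cancel.
  rw [detT_eq hP.v_ne_u, detT_eq hP.v_ne_u, map_mul, h3, h4, mul_mul_mul_comm, ← mul_pow]
  simp

theorem IsBreather.psiStar_eq (θ : ℝ) (p : Pt) :
    P.psiStar (amplitude P.wa P.wb P.κ₁ P.κ₂ θ) p = (rho P.κ₁ P.κ₂ : ℂ) *
      (starRingEnd ℂ) (P.psi (amplitude P.wa P.wb P.κ₁ P.κ₂ θ) p) := by
  have h0 := hP.conj_detT 0 p
  have h1 := hP.conj_detT 1 p
  simp only [Int.cast_zero, Int.cast_one, neg_zero] at h0 h1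
  exact psiStar_eq_of_conj θ hP.wa_ne_wb hP.κ₁_ne hP.κ₂_ne (by rw [map_div₀, h0, h1]) _

theorem IsBreather.isDS1SolutionOn (θ : ℝ) :
    IsDS1SolutionOn (rho P.κ₁ P.κ₂) (P.psi (amplitude P.wa P.wb P.κ₁ P.κ₂ θ)) P.phi
      {p | P.detT 0 p ≠ 0} := by
  have hg := hP.isGeneric
  have hA := amplitude_ne_zero θ hP.wa_ne_wb hP.κ₁_ne hP.κ₂_ne
  refine (isLax hg 0).isDS1SolutionOn (A := amplitude P.wa P.wb P.κ₁ P.κ₂ θ)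
    (h := P.h) ?_ (fun p hp => ?_) (fun p hp => phi_eq hg hp) (fun p _ => ?_) (fun p hp => ?_)
  · ext p
    exact detT_ne_zero_iff hP.v_ne_u 0 p
  · rw [psi, detT_one hg hp, mul_div_cancel_left₀ _ hp, mul_assoc]
  · refine phiOf_im_eq_zero (fun q => ?_) _ _
    simpa using hP.conj_detT 0 q
  · rw [rho_mul_normSqFun (hP.psiStar_eq θ p), psi, psiStar, detT_one hg hp, detT_neg_one hg hp,
      mul_div_cancel_left₀ _ hp, mul_div_cancel_left₀ _ hp]
    have hexp : Complex.exp (-Complex.I * (planePhase P.wa P.wb P.κ₁ P.κ₂ P.h p : ℂ)) *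
        Complex.exp (Complex.I * (planePhase P.wa P.wb P.κ₁ P.κ₂ P.h p : ℂ)) = 1 := by
      rw [← Complex.exp_add]; simp
    have hD : (P.wa : ℂ) - P.wb ≠ 0 := sub_ne_zero.mpr (by exact_mod_cast hP.wa_ne_wb)
    generalize Complex.exp (-Complex.I * _) = e₁ at hexp ⊢
    generalize Complex.exp (Complex.I * _) = e₂ at hexp ⊢
    field_simp
    linear_combination (-(P.κ₁ * P.κ₂ : ℂ) * detRatio P.wa P.wb P.u P.v (P.laxMatrix 0 p) *
      detRatio P.wb P.wa P.u P.v (P.laxMatrix 0 p)) * hexp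

end Breather

end DetData

/-! ### Density of the regular set of breathers -/

section Density

/-- On the line from `p` to `q` the function is analytic in one variable and nonzero at `q`. Its
zeros cannot accumulate at `p`, so nonzero values occur arbitrarily close to `p`. -/
theorem dense_ne_zero_of_analytic {f : Pt → ℂ} (hf : ContDiff ℝ (⊤ : WithTop ℕ∞) f) {q : Pt}
    (hq : f q ≠ 0) : Dense {p | f p ≠ 0} := by
  intro p
  have hline : ContDiff ℝ (⊤ : WithTop ℕ∞) fun s : ℝ => p + s • (q - p) :=
    contDiff_const.add (contDiff_id.smul contDiff_const)
  have hg : AnalyticOnNhd ℝ (fun s : ℝ => f (p + s • (q - p))) Set.univ :=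
    fun s _ => (hf.comp hline).contDiffAt.analyticAt
  have hne : ∀ᶠ s in 𝓝[≠] (0 : ℝ), f (p + s • (q - p)) ≠ 0 := by
    by_contra hcon
    have h1 := hg.eqOn_zero_of_preconnected_of_frequently_eq_zero isPreconnected_univ
      (Set.mem_univ 0) (by
        rw [Filter.not_eventually] at hcon
        exact hcon.mono fun s hs => not_not.mp hs)
    have h2 := h1 (Set.mem_univ 1)
    simp only [one_smul, add_sub_cancel, Pi.zero_apply] at h2
    exact hq h2
  have ht : Tendsto (fun s : ℝ => p + s • (q - p)) (𝓝[≠] 0) (𝓝 p) := by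
    have := hline.continuous.tendsto 0
    simp only [zero_smul, add_zero] at this
    exact this.mono_left nhdsWithin_le_nhds
  exact mem_closure_of_tendsto ht hne

/-- After clearing denominators, a kernel vector gives the polynomial `∑ x_k ∏_{j ≠ k} (X - u_j)`.
Its degree is below `|S|` and it vanishes at the `|S|` points `v_i`, hence it is zero; evaluating at
`u_k` isolates `x_k`. -/
theorem cauchy_kernel_eq_zero {ι : Type} [DecidableEq ι] {u v : ι → ℂ}
    (hu : Function.Injective u) (hv : Function.Injective v) (huv : ∀ i k, v i ≠ u k)
    (S : Finset ι) (x : ι → ℂ) (hx : ∀ i ∈ S, ∑ k ∈ S, 1 / (v i - u k) * x k = 0) :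
    ∀ k ∈ S, x k = 0 := by
  classical
  let f : Polynomial ℂ := ∑ k ∈ S, Polynomial.C (x k) *
    ∏ j ∈ S.erase k, (Polynomial.X - Polynomial.C (u j))
  have heval : ∀ w, f.eval w = ∑ k ∈ S, x k * ∏ j ∈ S.erase k, (w - u j) := by
    intro w
    simp [f, Polynomial.eval_finsetSum, Polynomial.eval_prod]
  have hdeg : f.degree < S.card := by
    refine (Polynomial.degree_sum_le _ _).trans_lt ((Finset.sup_lt_iff ?_).mpr fun k hk => ?_)
    · exact WithBot.bot_lt_coe S.card
    · rw [Polynomial.degree_mul, Polynomial.degree_prod]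
      refine (add_le_of_nonpos_left Polynomial.degree_C_le).trans_lt ?_
      simp only [Polynomial.degree_X_sub_C, Finset.sum_const, nsmul_eq_mul, mul_one]
      rw [Finset.card_erase_of_mem hk]
      exact_mod_cast Nat.sub_lt (Finset.card_pos.mpr ⟨k, hk⟩) one_pos
  have hf : f = 0 := by
    refine Polynomial.eq_zero_of_degree_lt_of_eval_index_eq_zero (v := v) S hv.injOn hdeg
      fun i hi => ?_
    rw [heval]
    have h1 : ∀ k ∈ S, x k * ∏ j ∈ S.erase k, (v i - u j) =
        (∏ j ∈ S, (v i - u j)) * (1 / (v i - u k) * x k) := by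
      intro k hk
      have := sub_ne_zero.mpr (huv i k)
      rw [← Finset.mul_prod_erase S _ hk]
      field_simp
    rw [Finset.sum_congr rfl h1, ← Finset.mul_sum, hx i hi, mul_zero]
  intro k hk
  have h2 := heval (u k)
  rw [hf, Polynomial.eval_zero, Finset.sum_eq_single_of_mem k hk] at h2
  · refine (mul_eq_zero.mp h2.symm).resolve_right (Finset.prod_ne_zero_iff.mpr fun j hj => ?_)
    exact sub_ne_zero.mpr fun h => Finset.ne_of_mem_erase hj (hu h).symm
  · intro j hj hjk
    rw [Finset.prod_eq_zero (Finset.mem_erase.mpr ⟨hjk.symm, hk⟩) (sub_self _), mul_zero]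

/-- The pole functions of two distinct points of `ℂ \ ℝ` cannot degenerate simultaneously. -/
theorem pole_nondegenerate {a b κ₁ κ₂ x y x' y' : ℝ} (hab : a ≠ b) (h₁ : κ₁ ≠ 0)
    (hy : y ≠ 0) (hy' : y' ≠ 0)
    (hne : x = x' → y ≠ y')
    (ha : y' / ((a - x') ^ 2 + y' ^ 2) = y / ((a - x) ^ 2 + y ^ 2))
    (hb : y' / ((b - x') ^ 2 + y' ^ 2) = y / ((b - x) ^ 2 + y ^ 2))
    (hW : κ₁ ^ 2 * (y / ((a - x) ^ 2 + y ^ 2) * ((a - x') / ((a - x') ^ 2 + y' ^ 2)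
        - (a - x) / ((a - x) ^ 2 + y ^ 2))) =
      κ₂ ^ 2 * (y / ((b - x) ^ 2 + y ^ 2) * ((b - x') / ((b - x') ^ 2 + y' ^ 2)
        - (b - x) / ((b - x) ^ 2 + y ^ 2)))) : False := by
  have hy2 : 0 < y ^ 2 := by positivity
  have hy2' : 0 < y' ^ 2 := by positivity
  obtain ⟨A, hA⟩ : ∃ A, A = (a - x) ^ 2 + y ^ 2 := ⟨_, rfl⟩
  obtain ⟨A', hA'⟩ : ∃ A', A' = (a - x') ^ 2 + y' ^ 2 := ⟨_, rfl⟩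
  obtain ⟨B, hB⟩ : ∃ B, B = (b - x) ^ 2 + y ^ 2 := ⟨_, rfl⟩
  obtain ⟨B', hB'⟩ : ∃ B', B' = (b - x') ^ 2 + y' ^ 2 := ⟨_, rfl⟩
  have pA : 0 < A := by rw [hA]; positivity
  have pA' : 0 < A' := by rw [hA']; positivity
  have pB : 0 < B := by rw [hB]; positivity
  have pB' : 0 < B' := by rw [hB']; positivity
  rw [← hA, ← hA'] at ha
  rw [← hB, ← hB'] at hb
  rw [← hA, ← hA', ← hB, ← hB'] at hW
  have e1 : y' * A = y * A' := by field_simp at ha; linarith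
  have e2 : y' * B = y * B' := by field_simp at hb; linarith
  -- This is the difference of the conditions at `a` and at `b`, divided by `a - b`.
  have hsum : ((a - x') * y - (a - x) * y') + ((b - x') * y - (b - x) * y') = 0 := by
    have h1 : (a - b) * (((a - x') * y - (a - x) * y') + ((b - x') * y - (b - x) * y')) = 0 := by
      rw [hA, hA'] at e1
      rw [hB, hB'] at e2
      linear_combination e2 - e1
    exact (mul_eq_zero.mp h1).resolve_left (sub_ne_zero.mpr hab)
  have hVa : (a - x') / A' - (a - x) / A = ((a - x') * y - (a - x) * y') / (A * y') := by
    field_simp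
    linear_combination (a - x') * e1
  have hVb : (b - x') / B' - (b - x) / B = ((b - x') * y - (b - x) * y') / (B * y') := by
    field_simp
    linear_combination (b - x') * e2
  rw [hVa, hVb] at hW
  -- The two numerators are opposite by `hsum`. The time condition therefore multiplies one of them
  -- by a sum of positive terms and equates the result to zero.
  have hna : (a - x') * y - (a - x) * y' = 0 := by
    have h1 : ((a - x') * y - (a - x) * y') * (κ₁ ^ 2 * B ^ 2 + κ₂ ^ 2 * A ^ 2) = 0 := by
      field_simp at hW
      linear_combination hW + κ₂ ^ 2 * A ^ 2 * hsum
    exact (mul_eq_zero.mp h1).resolve_right (by positivity)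
  have hyy : y = y' := by
    have h1 : (a - b) * (y - y') = 0 := by linear_combination 2 * hna - hsum
    exact sub_eq_zero.mp ((mul_eq_zero.mp h1).resolve_left (sub_ne_zero.mpr hab))
  have hxx : x = x' := by
    have h1 : (x - x') * y = 0 := by rw [← hyy] at hna; linear_combination hna
    exact sub_eq_zero.mp ((mul_eq_zero.mp h1).resolve_right hy)
  exact hne hxx hyy

end Density

namespace DetData

variable {N : ℕ} {P : DetData (Fin N ⊕ Fin N)}

/-- `Z_k` is linear, so it suffices to test the three basis vectors. If all real parts vanished
there, the imaginary parts of `V_a`, `V_b` and `κ₁² W_a - κ₂² W_b` would vanish, which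
`pole_nondegenerate` excludes. -/
theorem IsBreather.exists_re_Z_ne_zero (hP : P.IsBreather) (k : Fin N ⊕ Fin N) :
    ∃ p, (P.Z p k).re ≠ 0 := by
  by_contra! hcon
  have h1 := hcon (1, 0, 0)
  have h2 := hcon (0, 1, 0)
  have h3 := hcon (0, 0, 1)
  simp only [Z, Complex.ofReal_one, Complex.ofReal_zero, mul_one, mul_zero, zero_div, add_zero,
    sub_zero, zero_sub, zero_add] at h1 h2 h3
  have e1 : (P.V P.wa k).im = 0 := by
    have := hP.κ₁_ne
    simpa [this] using h1
  have e2 : (P.V P.wb k).im = 0 := by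
    have := hP.κ₂_ne
    simpa [this] using h2
  have e3 : P.κ₁ ^ 2 * (P.W P.wa k).im = P.κ₂ ^ 2 * (P.W P.wb k).im := by
    rw [mul_assoc, Complex.I_mul_re, ← Complex.ofReal_pow, ← Complex.ofReal_pow,
      show (1 / 2 : ℂ) = ((1 / 2 : ℝ) : ℂ) by push_cast; rfl, Complex.im_mul_ofReal,
      Complex.sub_im, Complex.im_ofReal_mul, Complex.im_ofReal_mul] at h3
    linarith
  have hinv : ∀ (c : ℝ) (w : ℂ), (1 / ((c : ℂ) - w)).im = w.im / ((c - w.re) ^ 2 + w.im ^ 2) ∧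
      (1 / ((c : ℂ) - w)).re = (c - w.re) / ((c - w.re) ^ 2 + w.im ^ 2) := by
    intro c w
    rw [one_div, Complex.inv_im, Complex.inv_re, Complex.normSq_apply]
    simp [pow_two]
  have hu : (P.u k).im ≠ 0 := fun h => hP.conj_u_ne k (Complex.conj_eq_iff_im.mpr h)
  have hv : (P.v k).im ≠ 0 := fun h => hP.v_ne_u k k.swap (by
    rw [← hP.conj_v, Complex.conj_eq_iff_im.mpr h])
  have hVim : ∀ c : ℝ, (P.V c k).im = 0 →
      (P.v k).im / ((c - (P.v k).re) ^ 2 + (P.v k).im ^ 2) =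
      (P.u k).im / ((c - (P.u k).re) ^ 2 + (P.u k).im ^ 2) := by
    intro c hc
    rw [V, Complex.sub_im, (hinv c _).1, (hinv c _).1] at hc
    linarith
  have hWim : ∀ c : ℝ, (P.V c k).im = 0 → (P.W c k).im =
      -2 * ((P.u k).im / ((c - (P.u k).re) ^ 2 + (P.u k).im ^ 2) *
      ((c - (P.v k).re) / ((c - (P.v k).re) ^ 2 + (P.v k).im ^ 2)
        - (c - (P.u k).re) / ((c - (P.u k).re) ^ 2 + (P.u k).im ^ 2))) := by
    intro c hc
    have h4 : P.W c k = -((1 / ((c : ℂ) - P.v k)) * (1 / ((c : ℂ) - P.v k))) +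
        (1 / ((c : ℂ) - P.u k)) * (1 / ((c : ℂ) - P.u k)) := by
      simp only [W, one_div, inv_pow, ← pow_two]
    rw [h4, Complex.add_im, Complex.neg_im, Complex.mul_im, Complex.mul_im, (hinv c _).1,
      (hinv c _).1, (hinv c _).2, (hinv c _).2, hVim c hc]
    ring
  rw [hWim _ e1, hWim _ e2] at e3
  exact pole_nondegenerate hP.wa_ne_wb hP.κ₁_ne hu hv
    (fun hre him => hP.v_ne_u k k (Complex.ext hre.symm him.symm)) (hVim _ e1) (hVim _ e2)
    (κ₁ := P.κ₁) (κ₂ := P.κ₂) (by linarith)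

end DetData

theorem tendsto_cexp_atTop_zero {w c : ℂ} (hw : w.re < 0) :
    Tendsto (fun s : ℝ => Complex.exp (s * w + c)) atTop (𝓝 0) := by
  rw [tendsto_zero_iff_norm_tendsto_zero]
  simp only [Complex.norm_exp, Complex.add_re, Complex.re_ofReal_mul]
  exact Real.tendsto_exp_atBot.comp
    (tendsto_atBot_add_const_right _ _ (tendsto_id.atTop_mul_const_of_neg hw))

theorem tendsto_det {ι α : Type} [Fintype ι] [DecidableEq ι] {l : Filter α}
    {M : α → Matrix ι ι ℂ} {L : Matrix ι ι ℂ}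
    (h : ∀ i j, Tendsto (fun x => M x i j) l (𝓝 (L i j))) :
    Tendsto (fun x => (M x).det) l (𝓝 L.det) := by
  have hc : Continuous fun A : Matrix ι ι ℂ => A.det := continuous_id.matrix_det
  exact (hc.tendsto L).comp (tendsto_pi_nhds.mpr fun i => tendsto_pi_nhds.mpr fun j => h i j)

namespace DetData

variable {N : ℕ} {P : DetData (Fin N ⊕ Fin N)}

/-- Each condition defines a dense open set, so the finitely many conditions have a common point. -/
theorem IsBreather.exists_forall_re_Z_ne_zero (hP : P.IsBreather) :
    ∃ p, ∀ k, (P.Z p k).re ≠ 0 := by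
  have hsmooth : ∀ (n : WithTop ℕ∞) k, ContDiff ℝ n fun p => (((P.Z p k).re : ℝ) : ℂ) := by
    intro n k
    have h1 : (fun p => P.Z p k) = fun p => P.z 0 p k + P.d k := by
      funext p; simp [z]
    have h2 : ContDiff ℝ n fun p => P.Z p k := by
      rw [h1]
      exact (P.contDiff_z 0 k).add contDiff_const
    exact Complex.ofRealCLM.contDiff.comp (Complex.reCLM.contDiff.comp h2)
  have hdense : ∀ k, Dense {p | (((P.Z p k).re : ℝ) : ℂ) ≠ 0} := by
    intro k
    obtain ⟨q, hq⟩ := hP.exists_re_Z_ne_zero k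
    exact dense_ne_zero_of_analytic (hsmooth _ k) (q := q) (by exact_mod_cast hq)
  have hopen : ∀ k, IsOpen {p | (((P.Z p k).re : ℝ) : ℂ) ≠ 0} := fun k =>
    isOpen_ne_fun (hsmooth 0 k).continuous continuous_const
  obtain ⟨p, hp⟩ := (dense_iInter_of_isOpen hopen hdense).nonempty
  exact ⟨p, fun k => by exact_mod_cast Set.mem_iInter.mp hp k⟩

theorem Z_smul {ι : Type} (P : DetData ι) (s : ℝ) (p : Pt) (k : ι) :
    P.Z (s • p) k = s * P.Z p k := by
  simp [Z]; ring

/-- Along the ray through `w`, each exponential tends to `0` or grows without bound according to the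
sign of `Re Z_i(w)`. Rescaling the growing rows gives a limit matrix `L` with Cauchy rows where `Re
Z_i > 0` and identity rows elsewhere. -/
theorem IsBreather.exists_detT_ne_zero (hP : P.IsBreather) (hu : Function.Injective P.u)
    (hv : Function.Injective P.v) : ∃ p, P.detT 0 p ≠ 0 := by
  obtain ⟨w, hw⟩ := hP.exists_forall_re_Z_ne_zero
  let L : Matrix (Fin N ⊕ Fin N) (Fin N ⊕ Fin N) ℂ := Matrix.of fun i j =>
    if 0 < (P.Z w i).re then 1 / (P.v i - P.u j) else if i = j then 1 else 0
  let c : ℝ → Fin N ⊕ Fin N → ℂ := fun s i =>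
    if 0 < (P.Z w i).re then 1 else (P.v i - P.u i) * Complex.exp (P.z 0 (s • w) i)
  -- The identity rows kill the corresponding coordinates of a kernel vector; the remaining ones lie
  -- in the kernel of a square Cauchy matrix.
  have hL : L.det ≠ 0 := by
    intro h0
    obtain ⟨x, hx0, hx⟩ := Matrix.exists_mulVec_eq_zero_iff.mpr h0
    have h1 : ∀ i, ¬ 0 < (P.Z w i).re → x i = 0 := by
      intro i hi
      have := congrFun hx i
      simpa [L, Matrix.mulVec, dotProduct, hi] using this
    have h2 := cauchy_kernel_eq_zero hu hv hP.v_ne_u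
      (Finset.univ.filter fun i => 0 < (P.Z w i).re) x fun i hi => by
        rw [Finset.mem_filter] at hi
        have h3 := congrFun hx i
        simp only [L, Matrix.mulVec, dotProduct, Matrix.of_apply, hi.2, if_true,
          Pi.zero_apply] at h3
        rw [← h3]
        refine Finset.sum_subset (Finset.subset_univ _) fun j _ hj => ?_
        rw [h1 j (by simpa using hj), mul_zero]
    refine hx0 (funext fun i => ?_)
    by_cases hi : 0 < (P.Z w i).re
    · exact h2 i (by simpa using hi)
    · exact h1 i hi
  have hz : ∀ (s : ℝ) i, P.z 0 (s • w) i = s * P.Z w i + -P.d i := by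
    intro s i
    rw [z, Z_smul]; ring
  have hlim : ∀ i j, Tendsto (fun s : ℝ => (Matrix.diagonal (c s) * P.laxMatrix 0 (s • w)) i j) atTop
      (𝓝 (L i j)) := by
    intro i j
    have h5 := sub_ne_zero.mpr (hP.v_ne_u i i)
    simp only [Matrix.diagonal_mul, c, L, laxMatrix, Matrix.of_apply]
    by_cases hi : 0 < (P.Z w i).re
    · simp only [hi, if_true, one_mul]
      by_cases hij : i = j
      · subst hij
        have h1 : Tendsto (fun s : ℝ => Complex.exp (-P.z 0 (s • w) i)) atTop (𝓝 0) := by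
          convert tendsto_cexp_atTop_zero (w := -P.Z w i) (c := P.d i) (by simpa using hi) using 3
          rw [hz]; ring
        simpa using (h1.div_const (P.v i - P.u i)).add_const (1 / (P.v i - P.u i))
      · simp only [hij, if_false, zero_add]
        exact tendsto_const_nhds
    · have hneg : (P.Z w i).re < 0 := lt_of_le_of_ne (not_lt.mp hi) (hw i)
      have h1 : Tendsto (fun s : ℝ => Complex.exp (P.z 0 (s • w) i)) atTop (𝓝 0) := by
        simp only [hz]
        exact tendsto_cexp_atTop_zero hneg
      have h2 : ∀ s : ℝ, (P.v i - P.u i) * Complex.exp (P.z 0 (s • w) i) *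
          ((if i = j then Complex.exp (-P.z 0 (s • w) i) / (P.v i - P.u i) else 0) +
            1 / (P.v i - P.u j)) = (if i = j then 1 else 0) +
            Complex.exp (P.z 0 (s • w) i) * ((P.v i - P.u i) / (P.v i - P.u j)) := by
        intro s
        have h6 : Complex.exp (P.z 0 (s • w) i) ≠ 0 := Complex.exp_ne_zero _
        rw [Complex.exp_neg]
        split_ifs
        · field_simp
        · ring
      simp only [hi, if_false, h2]
      simpa using (h1.mul_const ((P.v i - P.u i) / (P.v i - P.u j))).const_add
        (if i = j then (1 : ℂ) else 0)
  have hev := (tendsto_det hlim).eventually_ne hL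
  obtain ⟨s, hs⟩ := hev.exists
  refine ⟨s • w, (detT_ne_zero_iff hP.v_ne_u 0 _).mpr ?_⟩
  rw [Matrix.det_mul] at hs
  exact right_ne_zero_of_mul hs

theorem IsBreather.dense (hP : P.IsBreather) (hu : Function.Injective P.u)
    (hv : Function.Injective P.v) : Dense {p | P.detT 0 p ≠ 0} := by
  obtain ⟨q, hq⟩ := hP.exists_detT_ne_zero hu hv
  have h := dense_ne_zero_of_analytic (contDiff_det (P.contDiff_laxMatrix 0))
    ((detT_ne_zero_iff hP.v_ne_u 0 q).mp hq)
  convert h using 2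
  ext p
  exact detT_ne_zero_iff hP.v_ne_u 0 p

end DetData

/-! ### Rational breathers as solutions -/

namespace RatData

variable {N : ℕ} (Q : RatData N)

/-- The points `w_k` to which both `w_{u_k}` and `w_{v_k}` tend. -/
def node : Fin N ⊕ Fin N → ℂ := Sum.elim Q.u Q.v

/-- The sign `1` of an odd and `-1` of an even index. -/
def parity (N : ℕ) : Fin N ⊕ Fin N → ℂ := Sum.elim (fun _ => 1) fun _ => -1

theorem parity_mul_self (k : Fin N ⊕ Fin N) : parity N k * parity N k = 1 := by
  rcases k with k | k <;> simp [parity]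

theorem parity_ne_zero (k : Fin N ⊕ Fin N) : parity N k ≠ 0 :=
  left_ne_zero_of_mul_eq_one (parity_mul_self k)

theorem parity_swap (k : Fin N ⊕ Fin N) : parity N k.swap = -parity N k := by
  rcases k with k | k <;> simp [parity]

theorem conj_parity (k : Fin N ⊕ Fin N) : (starRingEnd ℂ) (parity N k) = parity N k := by
  rcases k with k | k <;> simp [parity]

theorem V_eq (c : ℝ) (k : Fin N ⊕ Fin N) :
    Q.V c k = parity N k * (1 / ((c : ℂ) - Q.node k) ^ 2) := by
  rcases k with k | k <;> simp [parity, V, node]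

theorem W_eq (c : ℝ) (k : Fin N ⊕ Fin N) :
    Q.W c k = parity N k * -(2 / ((c : ℂ) - Q.node k) ^ 3) := by
  rcases k with k | k <;> simp [parity, W, node]

theorem r_eq (k : Fin N ⊕ Fin N) : Q.r k = parity N k * -(((Q.wa : ℂ) - Q.wb) /
    (((Q.wa : ℂ) - Q.node k) * ((Q.wb : ℂ) - Q.node k))) := by
  rcases k with k | k <;> simp [parity, r, node]

/-- The matrix `𝕂_β` with its rows multiplied by signs. -/
noncomputable def laxMatrix (β : ℂ) (p : Pt) : Matrix (Fin N ⊕ Fin N) (Fin N ⊕ Fin N) ℂ :=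
  Matrix.of fun i k => if i = k then parity N i * (Q.z p i + β * Q.r i)
    else 1 / (Q.node i - Q.node k)

theorem detK_eq (β : ℂ) (p : Pt) :
    Q.detK β p = (∏ k, -parity N k) * (Q.laxMatrix β p).det := by
  rw [← Matrix.det_diagonal, ← Matrix.det_mul, detK]
  congr 1
  ext i k
  rcases i with i | i <;> rcases k with k | k <;>
  simp [K, laxMatrix, node, parity] <;> split_ifs with h <;> (try subst h) <;> ring

theorem prod_neg_parity_ne_zero : (∏ k, -parity N k) ≠ 0 :=
  Finset.prod_ne_zero_iff.mpr fun k _ => neg_ne_zero.mpr (parity_ne_zero k)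

theorem detK_ne_zero_iff (β : ℂ) (p : Pt) : Q.detK β p ≠ 0 ↔ (Q.laxMatrix β p).det ≠ 0 := by
  rw [detK_eq, mul_ne_zero_iff]
  exact and_iff_right prod_neg_parity_ne_zero

theorem z_hasLineDerivAt (p : Pt) (k : Fin N ⊕ Fin N) :
    HasLineDerivAt ℝ (fun x => Q.z x k) (Complex.I * Q.κ₁ * Q.V Q.wa k) p (1, 0, 0) ∧
    HasLineDerivAt ℝ (fun x => Q.z x k) (-(Complex.I * Q.κ₂ * Q.V Q.wb k)) p (0, 1, 0) ∧
    HasLineDerivAt ℝ (fun x => Q.z x k) (Complex.I * ((Q.κ₁ : ℂ) ^ 2 * Q.W Q.wa k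
      - (Q.κ₂ : ℂ) ^ 2 * Q.W Q.wb k) / 2) p (0, 0, 1) := by
  have key : ∀ (e : Pt) (c : ℂ), (∀ t : ℝ, Q.z (p + t • e) k = Q.z p k + t * c) →
      HasLineDerivAt ℝ (fun x => Q.z x k) c p e := by
    intro e c hc
    have h1 := ((Complex.ofRealCLM.hasDerivAt (x := (0 : ℝ))).mul_const c).const_add (Q.z p k)
    simp only [Complex.ofRealCLM_apply, Complex.ofReal_one, one_mul] at h1
    refine HasDerivAt.congr_of_eventuallyEq h1 (Eventually.of_forall fun t => ?_)
    exact hc t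
  refine ⟨key _ _ fun t => ?_, key _ _ fun t => ?_, key _ _ fun t => ?_⟩ <;>
  · simp [z]
    ring

theorem contDiff_z {n : WithTop ℕ∞} (k : Fin N ⊕ Fin N) : ContDiff ℝ n fun p => Q.z p k := by
  have h1 : ContDiff ℝ n fun p : Pt => (p.1 : ℂ) :=
    Complex.ofRealCLM.contDiff.comp contDiff_fst
  have h2 : ContDiff ℝ n fun p : Pt => (p.2.1 : ℂ) :=
    Complex.ofRealCLM.contDiff.comp (contDiff_fst.comp contDiff_snd)
  have h3 : ContDiff ℝ n fun p : Pt => (p.2.2 : ℂ) :=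
    Complex.ofRealCLM.contDiff.comp (contDiff_snd.comp contDiff_snd)
  unfold z
  exact (((contDiff_const.mul h1).sub (contDiff_const.mul h2)).add
    (contDiff_const.mul (h3.div_const 2))).sub contDiff_const

theorem contDiff_laxMatrix {n : WithTop ℕ∞} (β : ℂ) (i j : Fin N ⊕ Fin N) :
    ContDiff ℝ n fun p => Q.laxMatrix β p i j := by
  by_cases hij : i = j
  · simp only [laxMatrix, Matrix.of_apply, hij, if_true]
    exact contDiff_const.mul ((Q.contDiff_z j).add contDiff_const)
  · simp only [laxMatrix, Matrix.of_apply, hij, if_false]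
    exact contDiff_const

theorem laxMatrix_hasLineDerivAt {β : ℂ} {p e : Pt} {c : Fin N ⊕ Fin N → ℂ}
    (hc : ∀ k, HasLineDerivAt ℝ (fun x => Q.z x k) (c k) p e) (i j : Fin N ⊕ Fin N) :
    HasLineDerivAt ℝ (fun x => Q.laxMatrix β x i j) (if i = j then parity N i * c i else 0) p e := by
  by_cases hij : i = j
  · subst hij
    simp only [laxMatrix, Matrix.of_apply, if_true]
    convert ((hc i).fun_const_add (β * Q.r i)).fun_const_mul (parity N i) using 1
    funext x
    ring
  · simp only [laxMatrix, Matrix.of_apply, hij, if_false]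
    exact hasDerivAt_const (0 : ℝ) (1 / (Q.node i - Q.node j))

variable {Q} (hQ : Q.IsRationalBreather)

include hQ

theorem IsRationalBreather.conj_node (i : Fin N ⊕ Fin N) :
    (starRingEnd ℂ) (Q.node i) = Q.node i.swap := by
  rcases i with i | i
  · exact hQ.conj_u i
  · simp [node, ← hQ.conj_u i]

theorem IsRationalBreather.node_injective : Function.Injective Q.node := by
  rintro (i | i) (k | k) h
  · exact congrArg _ (hQ.u_inj h)
  · exact absurd h (hQ.u_ne_v i k)
  · exact absurd h.symm (hQ.u_ne_v k i)
  · exact congrArg _ (hQ.v_inj h)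

theorem IsRationalBreather.ofReal_ne_node (c : ℝ) (i : Fin N ⊕ Fin N) : (c : ℂ) ≠ Q.node i := by
  intro h
  have h1 := hQ.conj_node i
  rw [← h, Complex.conj_ofReal, h] at h1
  have h2 := hQ.node_injective h1
  rcases i with i | i <;> simp at h2

/-- Off the diagonal the entries are again of Cauchy type and are annihilated by the flows. On the
diagonal `u = v`, so only the rank-one terms survive; they give constant rates and an affine
diagonal. -/
theorem IsRationalBreather.isLax :
    IsLax Q.wa Q.wb Q.κ₁ Q.κ₂ Q.node Q.node (Q.laxMatrix 0) := by
  refine ⟨hQ.wa_ne_wb, hQ.ofReal_ne_node _, hQ.ofReal_ne_node _, hQ.ofReal_ne_node _,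
    hQ.ofReal_ne_node _, Q.contDiff_laxMatrix 0, ?_, ?_, ?_⟩
  all_goals
    intro p i j
    have h1 := sub_ne_zero.mpr (hQ.ofReal_ne_node Q.wa i)
    have h2 := sub_ne_zero.mpr (hQ.ofReal_ne_node Q.wa j)
    have h3 := sub_ne_zero.mpr (hQ.ofReal_ne_node Q.wb i)
    have h4 := sub_ne_zero.mpr (hQ.ofReal_ne_node Q.wb j)
    have hs : parity N i ^ 2 = 1 := by rw [pow_two, parity_mul_self]
  · convert Q.laxMatrix_hasLineDerivAt (fun k => (Q.z_hasLineDerivAt p k).1) i j using 1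
    simp only [Matrix.smul_apply, flowOne_apply, resolvent, laxMatrix, Matrix.of_apply,
      smul_eq_mul, V_eq]
    split_ifs with hij
    · subst hij
      field_simp
      rw [hs]
      ring
    · have h5 := sub_ne_zero.mpr (fun h => hij (hQ.node_injective h))
      field_simp
      ring
  · convert Q.laxMatrix_hasLineDerivAt (fun k => (Q.z_hasLineDerivAt p k).2.1) i j using 1
    simp only [Matrix.smul_apply, flowOne_apply, resolvent, laxMatrix, Matrix.of_apply,
      smul_eq_mul, V_eq]
    split_ifs with hij
    · subst hij
      field_simp
      rw [hs]
      ring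
    · have h5 := sub_ne_zero.mpr (fun h => hij (hQ.node_injective h))
      field_simp
      ring
  · convert Q.laxMatrix_hasLineDerivAt (fun k => (Q.z_hasLineDerivAt p k).2.2) i j using 1
    simp only [Matrix.smul_apply, Matrix.sub_apply, flowTwo_apply, resolvent, laxMatrix,
      Matrix.of_apply, smul_eq_mul, W_eq]
    split_ifs with hij
    · subst hij
      field_simp
      rw [hs]
      ring
    · have h5 := sub_ne_zero.mpr (fun h => hij (hQ.node_injective h))
      field_simp
      ring

/-- The row and column scalings are inverse on the diagonal, so they preserve the determinant. The
diagonal shift `β r` is exactly the diagonal of the rank-one term that they create off the diagonal.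
-/
theorem IsRationalBreather.detK_shift {β : ℂ} {a b : ℝ}
    (hr : ∀ i, parity N i * (β * Q.r i) =
      ((b : ℂ) - a) / (((a : ℂ) - Q.node i) * ((b : ℂ) - Q.node i)))
    {p : Pt} (hp : Q.detK 0 p ≠ 0) :
    Q.detK β p = Q.detK 0 p * detRatio a b Q.node Q.node (Q.laxMatrix 0 p) := by
  have hL := (Q.detK_ne_zero_iff 0 p).mp hp
  have h1 := det_mul_prod_eq_of_rank_one hL (M := Q.laxMatrix β p)
    (S := fun i => ((b : ℂ) - Q.node i) / ((a : ℂ) - Q.node i))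
    (T := fun i => ((a : ℂ) - Q.node i) / ((b : ℂ) - Q.node i))
    (x := resolvent a Q.node) (y := resolvent b Q.node) (c := (b : ℂ) - a) (fun i j => by
      have h1 := sub_ne_zero.mpr (hQ.ofReal_ne_node a i)
      have h2 := sub_ne_zero.mpr (hQ.ofReal_ne_node a j)
      have h3 := sub_ne_zero.mpr (hQ.ofReal_ne_node b i)
      have h4 := sub_ne_zero.mpr (hQ.ofReal_ne_node b j)
      simp only [laxMatrix, Matrix.of_apply, resolvent]
      split_ifs with hij
      · subst hij
        rw [mul_add, hr]
        field_simp
        ring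
      · have h5 := sub_ne_zero.mpr (fun h => hij (hQ.node_injective h))
        field_simp
        ring)
  have h2 : ∏ i, (((b : ℂ) - Q.node i) / ((a : ℂ) - Q.node i) *
      (((a : ℂ) - Q.node i) / ((b : ℂ) - Q.node i))) = 1 := by
    refine Finset.prod_eq_one fun i _ => ?_
    have h1 := sub_ne_zero.mpr (hQ.ofReal_ne_node a i)
    have h3 := sub_ne_zero.mpr (hQ.ofReal_ne_node b i)
    field_simp
  rw [h2, mul_one] at h1
  rw [detK_eq, detK_eq, detRatio, mul_assoc, h1]

theorem IsRationalBreather.detK_one {p : Pt} (hp : Q.detK 0 p ≠ 0) :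
    Q.detK 1 p = Q.detK 0 p * detRatio Q.wa Q.wb Q.node Q.node (Q.laxMatrix 0 p) := by
  refine hQ.detK_shift (fun i => ?_) hp
  rw [r_eq, one_mul, ← mul_assoc, parity_mul_self]
  ring

theorem IsRationalBreather.detK_neg_one {p : Pt} (hp : Q.detK 0 p ≠ 0) :
    Q.detK (-1) p = Q.detK 0 p * detRatio Q.wb Q.wa Q.node Q.node (Q.laxMatrix 0 p) := by
  refine hQ.detK_shift (fun i => ?_) hp
  rw [r_eq, mul_left_comm, ← mul_assoc (parity N i), parity_mul_self]
  ring

theorem IsRationalBreather.phi_eq {p : Pt} (hp : Q.detK 0 p ≠ 0) :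
    Q.phi p = phiBracket Q.wa Q.wb Q.κ₁ Q.κ₂ Q.h Q.node Q.node (Q.laxMatrix 0 p) :=
  hQ.isLax.phiOf_eq (γ := fun _ => ∏ k, -parity N k) (c₁ := 0) (c₂ := 0) (Q.detK_eq 0)
    (fun _ => prod_neg_parity_ne_zero)
    (fun p => by rw [zero_mul]; exact hasDerivAt_const (0 : ℝ) _)
    (fun p => by rw [zero_mul]; exact hasDerivAt_const (0 : ℝ) _) Q.h
    ((Q.detK_ne_zero_iff 0 p).mp hp)

theorem IsRationalBreather.conj_d_swap (k : Fin N ⊕ Fin N) :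
    (starRingEnd ℂ) (Q.d k) = Q.d k.swap := by
  rcases k with k | k
  · simp [← hQ.conj_d k]
  · exact hQ.conj_d k

theorem IsRationalBreather.conj_z (p : Pt) (k : Fin N ⊕ Fin N) :
    (starRingEnd ℂ) (Q.z p k) = Q.z p k.swap := by
  simp [z, V_eq, W_eq, hQ.conj_node, hQ.conj_d_swap, conj_parity, parity_swap, Complex.conj_ofNat]
  ring

theorem IsRationalBreather.conj_r (k : Fin N ⊕ Fin N) :
    (starRingEnd ℂ) (Q.r k) = -Q.r k.swap := by
  simp [r_eq, hQ.conj_node, conj_parity, parity_swap]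

/-- The conjugation symmetry of the determinants. -/
theorem IsRationalBreather.conj_detK (β : ℝ) (p : Pt) :
    (starRingEnd ℂ) (Q.detK β p) = Q.detK (-β) p := by
  have hswap : ∀ x : Fin N ⊕ Fin N, Equiv.sumComm (Fin N) (Fin N) x = x.swap := fun x => rfl
  have h1 : ((Q.laxMatrix β p).map (starRingEnd ℂ)) =
      (-(Q.laxMatrix (-β) p).submatrix (Equiv.sumComm (Fin N) (Fin N))
        (Equiv.sumComm (Fin N) (Fin N))).transpose := by
    ext i k
    simp only [laxMatrix, Matrix.map_apply, Matrix.of_apply, Matrix.transpose_apply,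
      Matrix.neg_apply, Matrix.submatrix_apply, hswap]
    by_cases hik : i = k
    · subst hik
      simp only [if_true, map_mul, map_add, conj_parity, hQ.conj_z, hQ.conj_r, parity_swap,
        Complex.conj_ofReal]
      ring
    · have hik' : k.swap ≠ i.swap := fun h => hik (Sum.swap_leftInverse.injective h).symm
      simp only [hik, hik', if_false, map_div₀, map_sub, map_one, hQ.conj_node]
      rw [← neg_sub (Q.node k.swap), one_div_neg_eq_neg_one_div]
  -- The sign from negating the matrix is trivial because its size `N + N` is even.
  have h4 : (starRingEnd ℂ) (Q.laxMatrix β p).det = (Q.laxMatrix (-β) p).det := by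
    rw [RingHom.map_det, RingHom.mapMatrix_apply, h1, Matrix.det_transpose, Matrix.det_neg,
      Matrix.det_submatrix_equiv_self]
    simp
  rw [detK_eq, detK_eq, map_mul, h4, map_prod]
  simp [conj_parity]

theorem IsRationalBreather.psiStar_eq (θ : ℝ) {p : Pt} (hp : Q.detK 0 p ≠ 0) :
    -((Q.κ₁ : ℂ) * Q.κ₂ / (amplitude Q.wa Q.wb Q.κ₁ Q.κ₂ θ * ((Q.wa : ℂ) - Q.wb) ^ 2)) *
      detRatio Q.wb Q.wa Q.node Q.node (Q.laxMatrix 0 p) *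
        Complex.exp (Complex.I * (planePhase Q.wa Q.wb Q.κ₁ Q.κ₂ Q.h p : ℂ)) =
      (rho Q.κ₁ Q.κ₂ : ℂ) *
      (starRingEnd ℂ) (Q.psi (amplitude Q.wa Q.wb Q.κ₁ Q.κ₂ θ) p) := by
  have h0 := hQ.conj_detK 0 p
  have h1 := hQ.conj_detK 1 p
  simp only [Complex.ofReal_zero, Complex.ofReal_one, neg_zero] at h0 h1
  exact psiStar_eq_of_conj θ hQ.wa_ne_wb hQ.κ₁_ne hQ.κ₂_ne
    (by rw [map_div₀, h0, h1, hQ.detK_neg_one hp, mul_div_cancel_left₀ _ hp]) _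

theorem IsRationalBreather.isDS1SolutionOn (θ : ℝ) :
    IsDS1SolutionOn (rho Q.κ₁ Q.κ₂) (Q.psi (amplitude Q.wa Q.wb Q.κ₁ Q.κ₂ θ)) Q.phi
      {p | Q.detK 0 p ≠ 0} := by
  have hA := amplitude_ne_zero θ hQ.wa_ne_wb hQ.κ₁_ne hQ.κ₂_ne
  refine hQ.isLax.isDS1SolutionOn (A := amplitude Q.wa Q.wb Q.κ₁ Q.κ₂ θ)
    (h := Q.h) ?_ (fun p hp => ?_) (fun p hp => hQ.phi_eq hp) (fun p _ => ?_) (fun p hp => ?_)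
  · ext p
    exact Q.detK_ne_zero_iff 0 p
  · rw [psi, hQ.detK_one hp, mul_div_cancel_left₀ _ hp, mul_assoc]
  · refine phiOf_im_eq_zero (fun q => ?_) _ _
    simpa using hQ.conj_detK 0 q
  · rw [rho_mul_normSqFun (hQ.psiStar_eq θ hp), psi, hQ.detK_one hp, mul_div_cancel_left₀ _ hp]
    have hexp : Complex.exp (-Complex.I * (planePhase Q.wa Q.wb Q.κ₁ Q.κ₂ Q.h p : ℂ)) *
        Complex.exp (Complex.I * (planePhase Q.wa Q.wb Q.κ₁ Q.κ₂ Q.h p : ℂ)) = 1 := by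
      rw [← Complex.exp_add]; simp
    have hD : (Q.wa : ℂ) - Q.wb ≠ 0 := sub_ne_zero.mpr (by exact_mod_cast hQ.wa_ne_wb)
    generalize Complex.exp (-Complex.I * _) = e₁ at hexp ⊢
    generalize Complex.exp (Complex.I * _) = e₂ at hexp ⊢
    field_simp
    linear_combination (-(Q.κ₁ * Q.κ₂ : ℂ) * detRatio Q.wa Q.wb Q.node Q.node (Q.laxMatrix 0 p) *
      detRatio Q.wb Q.wa Q.node Q.node (Q.laxMatrix 0 p)) * hexp

end RatData

/-! ### Polynomial degree and density for rational breathers -/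

namespace RatData

variable {N : ℕ} (Q : RatData N)

/-- The matrix `𝕂_β` with polynomial entries in `ξ, η, t`. -/
noncomputable def polyMatrix (β : ℂ) :
    Matrix (Fin N ⊕ Fin N) (Fin N ⊕ Fin N) (MvPolynomial (Fin 3) ℂ) :=
  Matrix.of fun i k =>
    if i = k then
      MvPolynomial.C (-(Complex.I * Q.κ₁ * Q.V Q.wa i)) * MvPolynomial.X 0 +
      MvPolynomial.C (Complex.I * Q.κ₂ * Q.V Q.wb i) * MvPolynomial.X 1 +
      MvPolynomial.C (-(Complex.I * ((Q.κ₁ : ℂ) ^ 2 * Q.W Q.wa i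
        - (Q.κ₂ : ℂ) ^ 2 * Q.W Q.wb i) / 2)) * MvPolynomial.X 2 +
      MvPolynomial.C (Q.d i - β * Q.r i)
    else MvPolynomial.C (Q.K 0 0 i k)

theorem K_diag (β : ℂ) (p : Pt) (i : Fin N ⊕ Fin N) : Q.K β p i i = -(Q.z p i + β * Q.r i) := by
  rcases i with i | i <;> simp [K]

theorem K_off_diag (β : ℂ) (p : Pt) {i k : Fin N ⊕ Fin N} (h : i ≠ k) :
    Q.K β p i k = Q.K 0 0 i k := by
  rcases i with i | i <;> rcases k with k | k
  · have : i ≠ k := fun h' => h (by rw [h'])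
    simp [K, this]
  · simp [K]
  · simp [K]
  · have : i ≠ k := fun h' => h (by rw [h'])
    simp [K, this]

theorem detK_eq_eval (β : ℂ) (p : Pt) : Q.detK β p =
    MvPolynomial.eval ![(p.1 : ℂ), (p.2.1 : ℂ), (p.2.2 : ℂ)] (Q.polyMatrix β).det := by
  rw [RingHom.map_det, detK]
  congr 1
  ext i k
  rw [RingHom.mapMatrix_apply, Matrix.map_apply, polyMatrix, Matrix.of_apply]
  split_ifs with hik
  · subst hik
    rw [K_diag, z]
    simp
    ring
  · rw [K_off_diag _ _ _ hik, MvPolynomial.eval_C]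

theorem totalDegree_det_polyMatrix_le (β : ℂ) : (Q.polyMatrix β).det.totalDegree ≤ 2 * N := by
  rw [Matrix.det_apply]
  refine MvPolynomial.totalDegree_finsetSum_le fun σ _ => ?_
  have h1 : (∏ i, Q.polyMatrix β (σ i) i).totalDegree ≤ 2 * N := by
    refine (MvPolynomial.totalDegree_finsetProd _ _).trans ?_
    refine (Finset.sum_le_card_nsmul _ _ 1 fun i _ => ?_).trans ?_
    · have hX : ∀ (c : ℂ) (j : Fin 3),
          (MvPolynomial.C c * MvPolynomial.X j : MvPolynomial (Fin 3) ℂ).totalDegree ≤ 1 := by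
        intro c j
        refine (MvPolynomial.totalDegree_mul _ _).trans ?_
        simp
      rw [polyMatrix, Matrix.of_apply]
      split_ifs
      · refine (MvPolynomial.totalDegree_add _ _).trans (max_le ?_
          (by rw [MvPolynomial.totalDegree_C]; exact zero_le_one))
        refine (MvPolynomial.totalDegree_add _ _).trans (max_le ?_ (hX _ _))
        exact (MvPolynomial.totalDegree_add _ _).trans (max_le (hX _ _) (hX _ _))
      · simp
    · simp [two_mul]
  rcases Int.units_eq_one_or (Equiv.Perm.sign σ) with h | h
  · rwa [h, one_smul]
  · rwa [h, Units.neg_smul, one_smul, MvPolynomial.totalDegree_neg]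

/-- The restriction of `det 𝕂_β` to the `ξ`-axis. -/
noncomputable def xiPolynomial (β : ℂ) : Polynomial ℂ :=
  MvPolynomial.aeval ![Polynomial.X, 0, 0] (Q.polyMatrix β).det

theorem xiPolynomial_eq (β : ℂ) : Q.xiPolynomial β = Matrix.det ((Polynomial.X : Polynomial ℂ) •
    (Matrix.diagonal fun i => -(Complex.I * Q.κ₁ * Q.V Q.wa i)).map Polynomial.C +
    (Q.K β 0).map Polynomial.C) := by
  rw [xiPolynomial, AlgHom.map_det]
  congr 1
  ext1 i k
  rw [AlgHom.mapMatrix_apply, Matrix.map_apply, polyMatrix, Matrix.of_apply]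
  split_ifs with hik
  · subst hik
    simp [K_diag, z]
    ring
  · simp [hik, K_off_diag Q β 0 hik]

variable {Q} (hQ : Q.IsRationalBreather)

include hQ

/-- Only the diagonal depends on `ξ`, so this coefficient is the product of the diagonal
coefficients `-iκ₁ V̂_{a,k}`. -/
theorem IsRationalBreather.coeff_xiPolynomial_ne_zero (β : ℂ) :
    (Q.xiPolynomial β).coeff (2 * N) ≠ 0 := by
  have hcard : 2 * N = Fintype.card (Fin N ⊕ Fin N) := by simp [two_mul]
  rw [hcard, xiPolynomial_eq, Polynomial.coeff_det_X_add_C_card, Matrix.det_diagonal]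
  refine Finset.prod_ne_zero_iff.mpr fun i _ => neg_ne_zero.mpr ?_
  have h1 := sub_ne_zero.mpr (hQ.ofReal_ne_node Q.wa i)
  have h2 : (Q.κ₁ : ℂ) ≠ 0 := by exact_mod_cast hQ.κ₁_ne
  rw [V_eq]
  exact mul_ne_zero (mul_ne_zero Complex.I_ne_zero h2)
    (mul_ne_zero (parity_ne_zero i) (one_div_ne_zero (pow_ne_zero 2 h1)))

theorem IsRationalBreather.totalDegree_det_polyMatrix (β : ℂ) :
    (Q.polyMatrix β).det.totalDegree = 2 * N := by
  refine le_antisymm (Q.totalDegree_det_polyMatrix_le β) ?_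
  have h1 := Polynomial.le_natDegree_of_ne_zero (hQ.coeff_xiPolynomial_ne_zero β)
  refine h1.trans ((MvPolynomial.aeval_natDegree_le _ le_rfl _ (n := 1) fun i => ?_).trans ?_)
  · fin_cases i <;> simp
  · rw [mul_one]

/-- Otherwise the restriction to the `ξ`-axis would vanish at every real number and so be the zero
polynomial, against its nonzero coefficient of degree `2N`. -/
theorem IsRationalBreather.exists_detK_ne_zero : ∃ p, Q.detK 0 p ≠ 0 := by
  by_contra! hcon
  refine hQ.coeff_xiPolynomial_ne_zero 0 ?_
  have h0 : Q.xiPolynomial 0 = 0 := by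
    refine Polynomial.eq_zero_of_infinite_isRoot _
      ((Set.infinite_range_of_injective Complex.ofReal_injective).mono ?_)
    rintro _ ⟨s, rfl⟩
    have h1 := hcon (s, 0, 0)
    rw [detK] at h1
    rw [Set.mem_ofPred_eq, Polynomial.IsRoot.def, xiPolynomial_eq, ← Polynomial.coe_evalRingHom,
      RingHom.map_det]
    refine Eq.trans ?_ h1
    congr 1
    ext i k
    by_cases hik : i = k
    · subst hik
      simp [K_diag, z]
      ring
    · simp [hik, K_off_diag Q 0 _ hik]
  rw [h0, Polynomial.coeff_zero]

theorem IsRationalBreather.dense : Dense {p | Q.detK 0 p ≠ 0} := by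
  obtain ⟨q, hq⟩ := hQ.exists_detK_ne_zero
  have h := dense_ne_zero_of_analytic (contDiff_det (Q.contDiff_laxMatrix 0))
    ((Q.detK_ne_zero_iff 0 q).mp hq)
  convert h using 2
  ext p
  exact Q.detK_ne_zero_iff 0 p

end RatData

/-! ### Degeneration of determinantal solutions to rational breathers -/

section Limits

variable {ι α : Type} [Fintype ι] [DecidableEq ι] {l : Filter α}

theorem tendsto_bracket {M : α → Matrix ι ι ℂ} {L : Matrix ι ι ℂ}
    (h : ∀ i j, Tendsto (fun x => M x i j) l (𝓝 (L i j))) (hL : L.det ≠ 0)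
    {q r : α → ι → ℂ} {q₀ r₀ : ι → ℂ} (hq : Tendsto q l (𝓝 q₀)) (hr : Tendsto r l (𝓝 r₀)) :
    Tendsto (fun x => bracket (M x) (q x) (r x)) l (𝓝 (bracket L q₀ r₀)) := by
  have hadj : ∀ i j, Tendsto (fun x => (M x).adjugate i j) l (𝓝 (L.adjugate i j)) := by
    intro i j
    simp only [Matrix.adjugate_apply]
    refine tendsto_det fun k m => ?_
    by_cases hk : k = j
    · subst hk
      simpa using tendsto_const_nhds
    · simpa [Matrix.updateRow_ne hk] using h k m
  have hinv : ∀ i j, Tendsto (fun x => (M x)⁻¹ i j) l (𝓝 (L⁻¹ i j)) := by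
    intro i j
    simpa [Matrix.inv_def] using ((tendsto_det h).inv₀ hL).mul (hadj i j)
  simp only [bracket_eq_sum]
  exact tendsto_finsetSum _ fun i _ => tendsto_finsetSum _ fun j _ =>
    (((tendsto_pi_nhds.mp hq i).mul (tendsto_pi_nhds.mp hr j)).mul (hinv i j))

theorem tendsto_detRatio {M : α → Matrix ι ι ℂ} {L : Matrix ι ι ℂ}
    (h : ∀ i j, Tendsto (fun x => M x i j) l (𝓝 (L i j))) (hL : L.det ≠ 0) (a b : ℝ)
    {u v : α → ι → ℂ} {u₀ v₀ : ι → ℂ}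
    (hu : ∀ c : ℝ, Tendsto (fun x => resolvent c (u x)) l (𝓝 (resolvent c u₀)))
    (hv : ∀ c : ℝ, Tendsto (fun x => resolvent c (v x)) l (𝓝 (resolvent c v₀))) :
    Tendsto (fun x => detRatio a b (u x) (v x) (M x)) l (𝓝 (detRatio a b u₀ v₀ L)) :=
  tendsto_const_nhds.add (tendsto_const_nhds.mul (tendsto_bracket h hL (hu b) (hv a)))

theorem tendsto_phiBracket {M : α → Matrix ι ι ℂ} {L : Matrix ι ι ℂ}
    (h : ∀ i j, Tendsto (fun x => M x i j) l (𝓝 (L i j))) (hL : L.det ≠ 0) (a b κ₁ κ₂ c : ℝ)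
    {u v : α → ι → ℂ} {u₀ v₀ : ι → ℂ}
    (hu : ∀ c : ℝ, Tendsto (fun x => resolvent c (u x)) l (𝓝 (resolvent c u₀)))
    (hv : ∀ c : ℝ, Tendsto (fun x => resolvent c (v x)) l (𝓝 (resolvent c v₀))) :
    Tendsto (fun x => phiBracket a b κ₁ κ₂ c (u x) (v x) (M x)) l
      (𝓝 (phiBracket a b κ₁ κ₂ c u₀ v₀ L)) := by
  have hb := fun {q r : α → ι → ℂ} {q₀ r₀ : ι → ℂ} (hq : Tendsto q l (𝓝 q₀))
    (hr : Tendsto r l (𝓝 r₀)) => tendsto_bracket h hL hq hr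
  unfold phiBracket
  refine (Tendsto.add ?_ ?_).add_const _ <;>
  exact (((((hb (hu _) ((hv _).pow 2)).sub (hb ((hu _).pow 2) (hv _))).sub
    ((hb (hu _) (hv _)).pow 2)).const_mul _).const_mul _).const_mul _

end Limits

namespace RatData

variable {N : ℕ} {Q : RatData N} (hQ : Q.IsRationalBreather)

/-- The factor `(1 ± parity)/2` is `1` when the point moves and `0` when it stays, so odd and even
indices can be treated together. -/
theorem deform_v (Q : RatData N) (α : Fin N ⊕ Fin N → ℂ) (ε : ℝ) (k : Fin N ⊕ Fin N) :
    (Q.deform α ε).v k = Q.node k + ε * ((1 + parity N k) / 2 * α k) := by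
  rcases k with k | k <;> simp [deform, node, parity]

theorem deform_u (Q : RatData N) (α : Fin N ⊕ Fin N → ℂ) (ε : ℝ) (k : Fin N ⊕ Fin N) :
    (Q.deform α ε).u k = Q.node k + ε * ((1 - parity N k) / 2 * α k) := by
  rcases k with k | k <;> simp [deform, node, parity]

theorem hasDerivAt_line (w c : ℂ) : HasDerivAt (fun ε : ℝ => w + ε * c) c 0 := by
  have h := ((Complex.ofRealCLM.hasDerivAt (x := (0 : ℝ))).mul_const c).const_add w
  simpa using h

theorem tendsto_line (w c : ℂ) : Tendsto (fun ε : ℝ => w + ε * c) (𝓝[>] 0) (𝓝 w) := by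
  have h := (hasDerivAt_line w c).continuousAt.tendsto
  simp only [Complex.ofReal_zero, zero_mul, add_zero] at h
  exact h.mono_left nhdsWithin_le_nhds

include hQ

theorem IsRationalBreather.eventually_isGeneric {α : Fin N ⊕ Fin N → ℂ} (hα : ∀ k, α k ≠ 0) :
    ∀ᶠ ε : ℝ in 𝓝[>] 0, (Q.deform α ε).IsGeneric := by
  have hv := fun k => by
    simpa only [← deform_v] using tendsto_line (Q.node k) ((1 + parity N k) / 2 * α k)
  have hu := fun k => by
    simpa only [← deform_u] using tendsto_line (Q.node k) ((1 - parity N k) / 2 * α k)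
  have h1 : ∀ i k, ∀ᶠ ε : ℝ in 𝓝[>] 0, (Q.deform α ε).v i ≠ (Q.deform α ε).u k := by
    intro i k
    by_cases hik : i = k
    · subst hik
      filter_upwards [self_mem_nhdsWithin] with ε hε h
      rw [deform_v, deform_u] at h
      have hε' : (ε : ℂ) ≠ 0 := by exact_mod_cast (ne_of_gt hε)
      have h2 : (ε : ℂ) * (parity N i * α i) = 0 := by linear_combination h
      exact mul_ne_zero hε' (mul_ne_zero (parity_ne_zero i) (hα i)) h2
    · exact (((hv i).sub (hu k)).eventually_ne
        (sub_ne_zero.mpr fun h => hik (hQ.node_injective h))).mono fun _ h => sub_ne_zero.mp h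
  have h2 : ∀ (c : ℝ) i, ∀ᶠ ε : ℝ in 𝓝[>] 0, (c : ℂ) ≠ (Q.deform α ε).u i := fun c i =>
    ((hu i).eventually_ne (hQ.ofReal_ne_node c i).symm).mono fun _ h => h.symm
  have h3 : ∀ (c : ℝ) i, ∀ᶠ ε : ℝ in 𝓝[>] 0, (c : ℂ) ≠ (Q.deform α ε).v i := fun c i =>
    ((hv i).eventually_ne (hQ.ofReal_ne_node c i).symm).mono fun _ h => h.symm
  filter_upwards [eventually_all.mpr fun i => eventually_all.mpr (h1 i),
    eventually_all.mpr (h2 Q.wa), eventually_all.mpr (h3 Q.wa),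
    eventually_all.mpr (h2 Q.wb), eventually_all.mpr (h3 Q.wb)] with ε e1 e2 e3 e4 e5
  exact ⟨hQ.wa_ne_wb, e1, e2, e3, e4, e5⟩

/-- At `ε = 0` the poles `u_k` and `v_k` coincide, so `V` and `W` vanish. Their first-order terms
are `α_k V̂` and `α_k Ŵ`; the summand `d` compensates for the `-d̂_k` contained in `Q.z`. -/
theorem IsRationalBreather.hasDerivAt_deform_Z (α : Fin N ⊕ Fin N → ℂ) (p : Pt)
    (k : Fin N ⊕ Fin N) :
    (Q.deform α 0).Z p k = 0 ∧
    HasDerivAt (fun ε : ℝ => (Q.deform α ε).Z p k) (α k * (Q.z p k + Q.d k)) 0 := by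
  have hpole : ∀ (c : ℝ) (w s : ℂ), (c : ℂ) - w ≠ 0 →
      HasDerivAt (fun ε : ℝ => 1 / ((c : ℂ) - (w + ε * s))) (s / ((c : ℂ) - w) ^ 2) 0 ∧
      HasDerivAt (fun ε : ℝ => 1 / ((c : ℂ) - (w + ε * s)) ^ 2) (2 * s / ((c : ℂ) - w) ^ 3) 0 := by
    intro c w s hw
    have h1 := ((hasDerivAt_line w s).const_sub (c : ℂ))
    have h2 := h1.inv (by simpa using hw)
    simp only [Complex.ofReal_zero, zero_mul, add_zero, neg_neg] at h2
    constructor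
    · simp only [one_div]
      exact h2
    · simp only [one_div, ← inv_pow]
      refine (h2.fun_pow 2).congr_deriv ?_
      simp
      field_simp
  have hV : ∀ c : ℝ, HasDerivAt (fun ε : ℝ => (Q.deform α ε).V c k) (α k * Q.V c k) 0 := by
    intro c
    have hw := sub_ne_zero.mpr (hQ.ofReal_ne_node c k)
    simp only [DetData.V, deform_u, deform_v]
    refine ((hpole c _ ((1 + parity N k) / 2 * α k) hw).1.fun_sub
      (hpole c _ ((1 - parity N k) / 2 * α k) hw).1).congr_deriv ?_
    rw [V_eq]
    ring
  have hW : ∀ c : ℝ, HasDerivAt (fun ε : ℝ => (Q.deform α ε).W c k) (α k * Q.W c k) 0 := by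
    intro c
    have hw := sub_ne_zero.mpr (hQ.ofReal_ne_node c k)
    simp only [DetData.W, deform_u, deform_v]
    refine ((hpole c _ ((1 + parity N k) / 2 * α k) hw).2.fun_neg.fun_add
      (hpole c _ ((1 - parity N k) / 2 * α k) hw).2).congr_deriv ?_
    rw [W_eq]
    ring
  refine ⟨by simp [DetData.Z, DetData.V, DetData.W, deform_u, deform_v], ?_⟩
  simp only [DetData.Z]
  refine HasDerivAt.congr_deriv (((((hV Q.wa).const_mul (Complex.I * Q.κ₁)).mul_const (p.1 : ℂ)).fun_sub
    (((hV Q.wb).const_mul (Complex.I * Q.κ₂)).mul_const (p.2.1 : ℂ))).fun_add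
    (((((hW Q.wa).const_mul ((Q.κ₁ : ℂ) ^ 2)).fun_sub
      ((hW Q.wb).const_mul ((Q.κ₂ : ℂ) ^ 2))).const_mul Complex.I).mul_const
      ((p.2.2 : ℂ) / 2))) ?_
  rw [z]
  ring

/-- The term `iπ` in `d_k` reverses the sign of the exponential, so the diagonal entry is `(1 -
exp(…))/(v_i - u_i)` with exponent vanishing at `ε = 0`. It is a multiple of a difference quotient,
and its limit is a derivative. -/
theorem IsRationalBreather.tendsto_laxMatrix {α : Fin N ⊕ Fin N → ℂ} (hα : ∀ k, α k ≠ 0) (p : Pt)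
    (i j : Fin N ⊕ Fin N) :
    Tendsto (fun ε : ℝ => (Q.deform α ε).laxMatrix 0 p i j) (𝓝[>] 0)
      (𝓝 (Q.laxMatrix 0 p i j)) := by
  simp only [DetData.laxMatrix, laxMatrix, Matrix.of_apply]
  by_cases hij : i = j
  · subst hij
    simp only [if_true, zero_mul, add_zero]
    obtain ⟨h0, h1⟩ := hQ.hasDerivAt_deform_Z α p i
    have h2 : HasDerivAt (fun ε : ℝ =>
        1 - Complex.exp (-((Q.deform α ε).Z p i - (0 + ε * (α i * Q.d i))))) (α i * Q.z p i) 0 := by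
      refine (((h1.fun_sub (hasDerivAt_line 0 (α i * Q.d i))).fun_neg.cexp).const_sub
        1).congr_deriv ?_
      simp [h0]
      ring
    have h3 : Tendsto _ (𝓝[>] (0 : ℝ)) (𝓝 _) := h2.tendsto_slope_zero_right
    simp only [zero_add, h0, Complex.ofReal_zero, zero_mul, sub_zero, neg_zero, Complex.exp_zero,
      sub_self] at h3
    have h4 := h3.const_mul (parity N i / α i)
    have h5 : parity N i / α i * (α i * Q.z p i) = parity N i * Q.z p i := by
      have := hα i
      field_simp
    rw [h5] at h4
    refine h4.congr' ?_
    filter_upwards [self_mem_nhdsWithin] with ε hε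
    have hε' : (ε : ℂ) ≠ 0 := by exact_mod_cast (ne_of_gt hε)
    have h6 : (Q.deform α ε).v i - (Q.deform α ε).u i = ε * (parity N i * α i) := by
      rw [deform_v, deform_u]; ring
    have h7 : Complex.exp (-(Q.deform α ε).z 0 p i) =
        -Complex.exp (-((Q.deform α ε).Z p i - ε * (α i * Q.d i))) := by
      have h8 : -(Q.deform α ε).z 0 p i =
          -((Q.deform α ε).Z p i - ε * (α i * Q.d i)) + Real.pi * Complex.I := by
        simp [DetData.z, deform]
        ring
      rw [h8, Complex.exp_add, Complex.exp_pi_mul_I, mul_neg_one]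
    have h9 := hα i
    have h10 : parity N i ≠ 0 := parity_ne_zero i
    have h11 : parity N i ^ 2 = 1 := by rw [pow_two, parity_mul_self]
    rw [h6, h7, Complex.real_smul, Complex.ofReal_inv]
    field_simp
    rw [h11]
    ring
  · simp only [hij, if_false, zero_add, deform_v, deform_u]
    exact ((tendsto_const_nhds (x := (1 : ℂ))).div ((tendsto_line _ _).sub (tendsto_line _ _))
      (sub_ne_zero.mpr fun h => hij (hQ.node_injective h)))

theorem IsRationalBreather.tendsto_resolvent (α : Fin N ⊕ Fin N → ℂ) (c : ℝ) :
    Tendsto (fun ε : ℝ => resolvent c (Q.deform α ε).u) (𝓝[>] 0) (𝓝 (resolvent c Q.node)) ∧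
    Tendsto (fun ε : ℝ => resolvent c (Q.deform α ε).v) (𝓝[>] 0) (𝓝 (resolvent c Q.node)) := by
  constructor <;> refine tendsto_pi_nhds.mpr fun k => ?_
  · simp only [resolvent, deform_u]
    exact tendsto_const_nhds.div (tendsto_const_nhds.sub (tendsto_line _ _))
      (sub_ne_zero.mpr (hQ.ofReal_ne_node c k))
  · simp only [resolvent, deform_v]
    exact tendsto_const_nhds.div (tendsto_const_nhds.sub (tendsto_line _ _))
      (sub_ne_zero.mpr (hQ.ofReal_ne_node c k))

/-- The rational solutions are limits of the determinantal ones. -/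
theorem IsRationalBreather.tendsto_deform {α : Fin N ⊕ Fin N → ℂ} (hα : ∀ k, α k ≠ 0) (θ : ℝ)
    {p : Pt} (hp : Q.detK 0 p ≠ 0) :
    Tendsto (fun ε : ℝ => (Q.deform α ε).psi (amplitude Q.wa Q.wb Q.κ₁ Q.κ₂ θ) p) (𝓝[>] 0)
      (𝓝 (Q.psi (amplitude Q.wa Q.wb Q.κ₁ Q.κ₂ θ) p)) ∧
    Tendsto (fun ε : ℝ => (Q.deform α ε).psiStar (amplitude Q.wa Q.wb Q.κ₁ Q.κ₂ θ) p) (𝓝[>] 0)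
      (𝓝 ((rho Q.κ₁ Q.κ₂ : ℂ) * (starRingEnd ℂ)
        (Q.psi (amplitude Q.wa Q.wb Q.κ₁ Q.κ₂ θ) p))) ∧
    Tendsto (fun ε : ℝ => (Q.deform α ε).phi p) (𝓝[>] 0) (𝓝 (Q.phi p)) := by
  have hM := hQ.tendsto_laxMatrix hα p
  have hL := (Q.detK_ne_zero_iff 0 p).mp hp
  have hu := fun c => (hQ.tendsto_resolvent α c).1
  have hv := fun c => (hQ.tendsto_resolvent α c).2
  -- The determinants of `𝕋_β` carry the factor `∏ (v_i - u_i)`, which degenerates as `ε → 0`. The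
  -- limits are therefore taken in the quotients and in the potential, expressed through brackets of
  -- the convergent matrix.
  have hev : ∀ᶠ ε : ℝ in 𝓝[>] 0, (Q.deform α ε).IsGeneric ∧ (Q.deform α ε).detT 0 p ≠ 0 := by
    filter_upwards [hQ.eventually_isGeneric hα, (tendsto_det hM).eventually_ne hL] with ε h1 h2
    exact ⟨h1, (DetData.detT_ne_zero_iff h1.v_ne_u 0 p).mpr h2⟩
  refine ⟨?_, ?_, ?_⟩
  · have h1 : Q.psi (amplitude Q.wa Q.wb Q.κ₁ Q.κ₂ θ) p = amplitude Q.wa Q.wb Q.κ₁ Q.κ₂ θ *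
        detRatio Q.wa Q.wb Q.node Q.node (Q.laxMatrix 0 p) *
        Complex.exp (-Complex.I * (planePhase Q.wa Q.wb Q.κ₁ Q.κ₂ Q.h p : ℂ)) := by
      rw [psi, hQ.detK_one hp, mul_div_cancel_left₀ _ hp]
    rw [h1]
    refine (((tendsto_detRatio hM hL Q.wa Q.wb hu hv).const_mul _).mul_const _).congr' ?_
    filter_upwards [hev] with ε hε
    rw [DetData.psi, DetData.detT_one hε.1 hε.2, mul_div_cancel_left₀ _ hε.2]
    rfl
  · rw [← hQ.psiStar_eq θ hp]
    refine (((tendsto_detRatio hM hL Q.wb Q.wa hu hv).const_mul _).mul_const _).congr' ?_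
    filter_upwards [hev] with ε hε
    rw [DetData.psiStar, DetData.detT_neg_one hε.1 hε.2, mul_div_cancel_left₀ _ hε.2]
    rfl
  · rw [hQ.phi_eq hp]
    refine (tendsto_phiBracket hM hL Q.wa Q.wb Q.κ₁ Q.κ₂ Q.h hu hv).congr' ?_
    filter_upwards [hev] with ε hε
    rw [DetData.phi_eq hε.1 hε.2]
    rfl

theorem IsRationalBreather.eventually_isBreather {α : Fin N ⊕ Fin N → ℂ} (hα : ∀ k, α k ≠ 0)
    (hconj : ∀ k : Fin N, (starRingEnd ℂ) (α (Sum.inl k)) = α (Sum.inr k)) :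
    ∀ᶠ ε : ℝ in 𝓝[>] 0, (Q.deform α ε).IsBreather := by
  filter_upwards [hQ.eventually_isGeneric hα] with ε hε
  -- The witness `-1` comes from `conj (iπ) = iπ - 2πi`.
  refine ⟨hQ.κ₁_ne, hQ.κ₂_ne, hQ.wa_ne_wb, hε.v_ne_u, fun k => ⟨-1, ?_⟩, fun k => ?_, fun k => ?_⟩
  · simp only [deform, map_add, map_mul, Complex.conj_ofReal, Complex.conj_I, hconj,
      ← hQ.conj_d k, Complex.conj_conj]
    push_cast
    ring
  · simp [deform, ← hQ.conj_u k]
  · simp [deform, ← hQ.conj_u k, hconj]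

end RatData

end DaveyStewartson

theorem mainTheorem8 (N : ℕ) (hN : 1 ≤ N) (θ : ℝ) :
    -- the N-breathers
    (∀ P : DaveyStewartson.DetData (Fin N ⊕ Fin N), P.IsBreather →
      (∀ p, P.detT 0 p ≠ 0 →
        P.psiStar (DaveyStewartson.amplitude P.wa P.wb P.κ₁ P.κ₂ θ) p =
          (DaveyStewartson.rho P.κ₁ P.κ₂ : ℂ) * (starRingEnd ℂ)
            (P.psi (DaveyStewartson.amplitude P.wa P.wb P.κ₁ P.κ₂ θ) p)) ∧
      DaveyStewartson.IsDS1SolutionOn (DaveyStewartson.rho P.κ₁ P.κ₂)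
        (P.psi (DaveyStewartson.amplitude P.wa P.wb P.κ₁ P.κ₂ θ)) P.phi
        {p | P.detT 0 p ≠ 0} ∧
      (Function.Injective P.u → Function.Injective P.v → Dense {p | P.detT 0 p ≠ 0})) ∧
    -- the N-rational breathers
    (∀ Q : DaveyStewartson.RatData N, Q.IsRationalBreather →
      -- both determinants are polynomials of degree 2N in ξ, η, t
      (∀ β : ℂ, ∃ F : MvPolynomial (Fin 3) ℂ, F.totalDegree = 2 * N ∧
        ∀ p : DaveyStewartson.Pt,
          Q.detK β p = MvPolynomial.eval ![(p.1 : ℂ), (p.2.1 : ℂ), (p.2.2 : ℂ)] F) ∧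
      Dense {p | Q.detK 0 p ≠ 0} ∧
      DaveyStewartson.IsDS1SolutionOn (DaveyStewartson.rho Q.κ₁ Q.κ₂)
        (Q.psi (DaveyStewartson.amplitude Q.wa Q.wb Q.κ₁ Q.κ₂ θ)) Q.phi
        {p | Q.detK 0 p ≠ 0} ∧
      -- they are limits of the determinantal solutions, and of breathers
      (∀ α : Fin N ⊕ Fin N → ℂ, (∀ k, α k ≠ 0) →
        (∀ p, Q.detK 0 p ≠ 0 →
          Tendsto (fun ε : ℝ => (Q.deform α ε).psi
              (DaveyStewartson.amplitude Q.wa Q.wb Q.κ₁ Q.κ₂ θ) p) (𝓝[>] 0)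
            (𝓝 (Q.psi (DaveyStewartson.amplitude Q.wa Q.wb Q.κ₁ Q.κ₂ θ) p)) ∧
          Tendsto (fun ε : ℝ => (Q.deform α ε).psiStar
              (DaveyStewartson.amplitude Q.wa Q.wb Q.κ₁ Q.κ₂ θ) p) (𝓝[>] 0)
            (𝓝 ((DaveyStewartson.rho Q.κ₁ Q.κ₂ : ℂ) * (starRingEnd ℂ)
              (Q.psi (DaveyStewartson.amplitude Q.wa Q.wb Q.κ₁ Q.κ₂ θ) p))) ∧
          Tendsto (fun ε : ℝ => (Q.deform α ε).phi p) (𝓝[>] 0) (𝓝 (Q.phi p))) ∧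
        ((∀ k : Fin N, (starRingEnd ℂ) (α (Sum.inl k)) = α (Sum.inr k)) →
          ∀ᶠ ε : ℝ in 𝓝[>] 0, (Q.deform α ε).IsBreather))) := by
  refine ⟨fun P hP => ⟨fun p _ => hP.psiStar_eq θ p, hP.isDS1SolutionOn θ, hP.dense⟩,
    fun Q hQ => ⟨fun β => ⟨(Q.polyMatrix β).det, hQ.totalDegree_det_polyMatrix β,
      Q.detK_eq_eval β⟩, hQ.dense, hQ.isDS1SolutionOn θ, fun α hα =>
      ⟨fun p hp => hQ.tendsto_deform hα θ hp, hQ.eventually_isBreather hα⟩⟩⟩
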